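/- Let $k$ be an algebraically closed field of characteristic $2$. For a homogeneous polynomial $G\in H^0(\mathbb P^2,\mathcal O_{\mathbb P^2}(6))$ of degree $6$ over $k$, let $\pi_G:Y_G\to\mathbb P^2$ be the purely inseparable double cover defined by $W^2=G(X,Y,Z)$, that is, $Y_G=\operatorname{Proj} k[X,Y,Z,W]/(W^2-G)$ with $\deg X=\deg Y=\deg Z=1$ and $\deg W=3$, with the projection induced by $k[X,Y,Z]\subset k[X,Y,Z,W]/(W^2-G)$. Since $\mathcal O_{\mathbb P^2}(6)\cong\mathcal O_{\mathbb P^2}(3)^{\otimes 2}$ has transition functions that are squares and $k$ has characteristic $2$, the differentials of the local functions $G/X^6$, $G/Y^6$, $G/Z^6$ define a global section $dG$ of $\Omega^1_{\mathbb P^2}(6)$; let $Z(dG)\subset\mathbb P^2$ be the closed subscheme defined by $dG=0$. Let $\mathcal U$ be the set of all non-zero homogeneous polynomials $G$ of degree $6$ such that $Y_G$ has exactly $21$ singular points and each of them is an ordinary node (a singularity whose completed local ring is isomorphic to $k[[x,y,z]]/(xy-z^2)$). Let $G,G'\in\mathcal U$. Then the following conditions are equivalent: (i) $Y_G$ and $Y_{G'}$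 are isomorphic as schemes over $\mathbb P^2$; (ii) $Z(dG)=Z(dG')$ as closed subschemes of $\mathbb P^2$; (iii) there exist $c\in k^\times$ and a homogeneous polynomial $H\in H^0(\mathbb P^2,\mathcal O_{\mathbb P^2}(3))$ of degree $3$ such that $G'=cG+H^2$. -/

import Mathlib

open AlgebraicGeometry CategoryTheory CategoryTheory.Limits

namespace PlaneDoubleCover

universe u

section Plane

variable (k : Type u) [Field k]

/-- The homogeneous coordinate ring `k[X₀, X₁, X₂]` of the projective plane. -/
abbrev CoordRing : Type u := MvPolynomial (Fin 3) k

/-- The space `H⁰(ℙ², 𝒪(d))` of homogeneous polynomials of degree `d`. -/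
abbrev Form (d : ℕ) : Submodule k (CoordRing k) := MvPolynomial.homogeneousSubmodule (Fin 3) k d

noncomputable instance formGradedAlgebra : GradedAlgebra (Form k) := MvPolynomial.gradedAlgebra

/-- The projective plane over `k`. -/
noncomputable abbrev P2 : Scheme.{u} := Proj (Form k)

lemma X_mem (i : Fin 3) : (MvPolynomial.X i : CoordRing k) ∈ Form k 1 :=
  MvPolynomial.isHomogeneous_X k i

/-- The coordinate ring of the standard affine chart `{Xᵢ ≠ 0}` of the plane. It is an algebra over
the ring `Form k 0` of constant polynomials. -/
abbrev ChartRing (i : Fin 3) : Type u :=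
  HomogeneousLocalization.Away (Form k) (MvPolynomial.X i : CoordRing k)

/-- The inclusion of the standard affine chart `{Xᵢ ≠ 0}`. -/
noncomputable def chartMap (i : Fin 3) : Spec (.of (ChartRing k i)) ⟶ P2 k :=
  Proj.awayι (Form k) (MvPolynomial.X i) (X_mem k i) Nat.one_pos

end Plane

section ZeroScheme

variable {k : Type u} [Field k]

/-- The ideal of the zero scheme of a section `ω` of a locally free module `M` over `A`: it is
generated by the values at `ω` of the linear forms on `M`. -/
def zeroIdeal {A M : Type*} [CommRing A] [AddCommGroup M] [Module A M] (ω : M) : Ideal A :=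
  LinearMap.range (Module.Dual.eval A M ω)

/-- The regular function `G / Xᵢ⁶` on the chart `{Xᵢ ≠ 0}`. -/
noncomputable def dehomogenize (G : Form k 6) (i : Fin 3) : ChartRing k i :=
  HomogeneousLocalization.Away.mk (Form k) (X_mem k i) 6 G G.2

/-- The closed subscheme `Z(dG)` of the plane, given by its ideal sheaf. In characteristic two the
functions `G / Xᵢ⁶` differ on overlaps of the charts by squares of units, so that the differentials
`d(G / Xᵢ⁶)` define a section `dG` of `Ω¹(6)`. A function lies in the ideal sheaf of `Z(dG)` if and
only if its restriction to each chart lies in the ideal of the zero scheme of `d(G / Xᵢ⁶)`. -/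
noncomputable def zeroSchemeD (G : Form k 6) : (P2 k).IdealSheafData :=
  ⨅ i : Fin 3, (Scheme.IdealSheafData.ofIdealTop
    ((zeroIdeal (A := ChartRing k i)
      (KaehlerDifferential.D (Form k 0) (ChartRing k i) (dehomogenize G i))).comap
        (Scheme.ΓSpecIso (.of (ChartRing k i))).hom.hom)).map (chartMap k i)

end ZeroScheme

section Cover

variable {k : Type u} [Field k] (G : Form k 6)

/-- The ring `k[X₀, X₁, X₂][W] / (W² - G)`. -/
abbrev CoverRing : Type u :=
  AdjoinRoot (Polynomial.X ^ 2 - Polynomial.C (G : CoordRing k))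

/-- The grading of `k[X₀, X₁, X₂][W] / (W² - G)` with `deg Xᵢ = 1` and `deg W = 3`. -/
noncomputable def coverGrading (n : ℕ) : Submodule k (CoverRing G) :=
  Submodule.span k {x | ∃ m j : ℕ, m + 3 * j = n ∧ ∃ a ∈ Form k m,
    x = AdjoinRoot.of _ a * AdjoinRoot.root _ ^ j}

lemma of_mem {m : ℕ} {a : CoordRing k} (ha : a ∈ Form k m) :
    (AdjoinRoot.of _ a : CoverRing G) ∈ coverGrading G m :=
  Submodule.subset_span ⟨m, 0, by simp, a, ha, by simp⟩

lemma root_mem : (AdjoinRoot.root _ : CoverRing G) ∈ coverGrading G 3 :=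
  Submodule.subset_span ⟨0, 1, by simp, 1, MvPolynomial.isHomogeneous_one _ _, by simp⟩

lemma root_sq : (AdjoinRoot.root _ : CoverRing G) ^ 2 = AdjoinRoot.of _ (G : CoordRing k) := by
  have h := AdjoinRoot.eval₂_root (Polynomial.X ^ 2 - Polynomial.C (G : CoordRing k))
  simpa [Polynomial.eval₂_sub, sub_eq_zero] using h

instance coverGradedMonoid : SetLike.GradedMonoid (coverGrading G) where
  one_mem := by
    simpa using of_mem G (MvPolynomial.isHomogeneous_one (Fin 3) k)
  mul_mem := by
    intro i j x y hx hy
    induction hx using Submodule.span_induction with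
    | zero => simp
    | add x x' _ _ h h' => rw [add_mul]; exact add_mem h h'
    | smul c x _ h => rw [smul_mul_assoc]; exact Submodule.smul_mem _ _ h
    | mem x hx =>
      induction hy using Submodule.span_induction with
      | zero => simp
      | add y y' _ _ h h' => rw [mul_add]; exact add_mem h h'
      | smul c y _ h => rw [mul_smul_comm]; exact Submodule.smul_mem _ _ h
      | mem y hy =>
        obtain ⟨m, s, rfl, a, ha, rfl⟩ := hx
        obtain ⟨n, t, rfl, b, hb, rfl⟩ := hy
        refine Submodule.subset_span ⟨m + n, s + t, by ring, a * b, ha.mul hb, ?_⟩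
        rw [map_mul]; ring

/-- The inclusion of the forms of degree `n` into the degree `n` part of the cover ring. -/
noncomputable def formIncl (n : ℕ) : Form k n →ₗ[k] coverGrading G n where
  toFun a := ⟨AdjoinRoot.of _ (a : CoordRing k), of_mem G a.2⟩
  map_add' a b := by ext; simp
  map_smul' c a := by
    ext
    simp [Algebra.smul_def]
    rfl

/-- The splitting of a polynomial in `X₀, X₁, X₂` into graded components of the cover ring. -/
noncomputable def splitPoly : CoordRing k →ₐ[k] DirectSum ℕ fun n => coverGrading G n :=
  (DirectSum.toAlgebra k (fun n => Form k n)
    (fun n => (DirectSum.lof k ℕ (fun n => coverGrading G n) n).comp (formIncl G n))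
    (by
      simp only [LinearMap.comp_apply, DirectSum.lof_eq_of, DirectSum.one_def]
      exact congrArg _ (Subtype.ext (map_one _)))
    (by
      intro i j a b
      simp only [LinearMap.comp_apply, DirectSum.lof_eq_of, DirectSum.of_mul_of]
      exact congrArg _ (Subtype.ext (map_mul _ _ _)))).comp
    (DirectSum.decomposeAlgEquiv (Form k)).toAlgHom

lemma splitPoly_of_mem {m : ℕ} {a : CoordRing k} (ha : a ∈ Form k m) :
    splitPoly G a = DirectSum.of (fun n => coverGrading G n) m
      ⟨AdjoinRoot.of _ a, of_mem G ha⟩ := by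
  have : DirectSum.decompose (Form k) a = DirectSum.of (fun n => Form k n) m ⟨a, ha⟩ :=
    DirectSum.decompose_of_mem _ ha
  simp only [splitPoly, AlgHom.comp_apply]
  change DirectSum.toAlgebra k _ _ _ _ (DirectSum.decompose (Form k) a) = _
  rw [this, ← DirectSum.lof_eq_of k]
  exact DirectSum.toModule_lof _ _ _

/-- The splitting of an element of the cover ring into graded components. -/
noncomputable def splitCover : CoverRing G →ₐ[k] DirectSum ℕ fun n => coverGrading G n :=
  AdjoinRoot.liftAlgHom _ (splitPoly G)
    (DirectSum.of (fun n => coverGrading G n) 3 ⟨AdjoinRoot.root _, root_mem G⟩) (by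
      rw [Polynomial.eval₂_sub, Polynomial.eval₂_pow, Polynomial.eval₂_X, Polynomial.eval₂_C,
        sub_eq_zero]
      erw [splitPoly_of_mem G G.2]
      rw [DirectSum.ofPow]
      refine DirectSum.of_eq_of_gradedMonoid_eq ?_
      refine Sigma.subtype_ext rfl ?_
      exact root_sq G)

lemma splitCover_of (a : CoordRing k) : splitCover G (AdjoinRoot.of _ a) = splitPoly G a := by
  unfold splitCover
  exact AdjoinRoot.liftAlgHom_of _ _ _ _ _

lemma splitCover_root : splitCover G (AdjoinRoot.root _) =
    DirectSum.of (fun n => coverGrading G n) 3 ⟨AdjoinRoot.root _, root_mem G⟩ := by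
  unfold splitCover
  exact AdjoinRoot.liftAlgHom_root _ _ _ _

lemma splitCover_of_mem {n : ℕ} {x : CoverRing G} (hx : x ∈ coverGrading G n) :
    splitCover G x = DirectSum.of (fun n => coverGrading G n) n ⟨x, hx⟩ := by
  induction hx using Submodule.span_induction with
  | zero => rw [map_zero]; exact (map_zero _).symm
  | add x y hx hy h h' =>
    rw [map_add, h, h', ← map_add]
    rfl
  | smul c x hx h =>
    rw [map_smul, h, ← DirectSum.of_smul]
    rfl
  | mem x hx =>
    obtain ⟨m, j, rfl, a, ha, rfl⟩ := hx
    rw [map_mul, map_pow, splitCover_of, splitCover_root, splitPoly_of_mem G ha, DirectSum.ofPow, DirectSum.of_mul_of]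
    refine DirectSum.of_eq_of_gradedMonoid_eq (Sigma.subtype_ext ?_ rfl)
    exact congrArg (m + ·) (mul_comm j 3)

noncomputable instance coverGradedAlgebra : GradedAlgebra (coverGrading G) :=
  GradedAlgebra.ofAlgHom _ (splitCover G)
    (by
      have h1 : (DirectSum.coeAlgHom (coverGrading G)).comp (splitPoly G) =
          AdjoinRoot.ofAlgHom k _ := by
        refine MvPolynomial.algHom_ext fun i => ?_
        rw [AlgHom.comp_apply, splitPoly_of_mem G (X_mem k i), DirectSum.coeAlgHom_of]
        rfl
      refine AlgHom.ext fun x => ?_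
      induction x using AdjoinRoot.induction_on with
      | ih p =>
        induction p using Polynomial.induction_on' with
        | add p q hp hq => rw [map_add, map_add, hp, hq, ← map_add]
        | monomial n a =>
          rw [← Polynomial.C_mul_X_pow_eq_monomial, map_mul, map_pow, AdjoinRoot.mk_C,
            AdjoinRoot.mk_X, map_mul, map_mul, map_pow, map_pow]
          refine congrArg₂ (fun u v => u * v ^ n) ?_ ?_
          · rw [AlgHom.comp_apply, splitCover_of]
            exact DFunLike.congr_fun h1 a
          · rw [AlgHom.comp_apply, splitCover_of_mem G (root_mem G), DirectSum.coeAlgHom_of]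
            rfl)
    (fun _ x => splitCover_of_mem G x.2)

/-- The surface `Y_G`, with equation `W² = G` in the weighted projective space `ℙ(1, 1, 1, 3)`. -/
noncomputable abbrev coverSurface : Scheme.{u} := Proj (coverGrading G)

/-- The inclusion of graded rings `k[X₀, X₁, X₂] → k[X₀, X₁, X₂][W] / (W² - G)`. -/
noncomputable def coordIncl : GradedRingHom (Form k) (coverGrading G) where
  __ := AdjoinRoot.of (Polynomial.X ^ 2 - Polynomial.C (G : CoordRing k))
  map_mem h := of_mem G h

/-- The images of the three coordinates in the cover ring. -/
noncomputable abbrev coverCoord (i : Fin 3) : CoverRing G := coordIncl G (MvPolynomial.X i)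

lemma coverCoord_mem (i : Fin 3) : coverCoord G i ∈ coverGrading G 1 :=
  of_mem G (X_mem k i)

lemma iSup_basicOpen_coverCoord :
    ⨆ i, Proj.basicOpen (coverGrading G) (coverCoord G i) = ⊤ := by
  refine top_le_iff.mp fun x _ => TopologicalSpace.Opens.mem_iSup.mpr ?_
  by_contra! H
  have hX : ∀ i, coverCoord G i ∈ x.asHomogeneousIdeal.toIdeal := by
    intro i
    by_contra h
    exact H i h
  have := x.isPrime
  have hof : ∀ m : ℕ, 0 < m → ∀ a ∈ Form k m,
      (AdjoinRoot.of _ a : CoverRing G) ∈ x.asHomogeneousIdeal.toIdeal := by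
    intro m hm a ha
    have h1 : a ∈ Ideal.span (MvPolynomial.X '' Set.univ : Set (CoordRing k)) := by
      rw [MvPolynomial.mem_ideal_span_X_image]
      intro d hd
      have hdeg : d.degree = m := by
        have := ha (MvPolynomial.mem_support_iff.mp hd)
        rwa [Finsupp.degree_eq_weight_one]
      by_contra! h0
      have : d = 0 := Finsupp.ext fun i => h0 i (Set.mem_univ i)
      rw [this] at hdeg
      simp at hdeg
      omega
    have h2 : Ideal.span (MvPolynomial.X '' Set.univ : Set (CoordRing k)) ≤
        x.asHomogeneousIdeal.toIdeal.comap (AdjoinRoot.of _) := by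
      rw [Ideal.span_le]
      rintro _ ⟨i, _, rfl⟩
      exact hX i
    exact h2 h1
  have hW : (AdjoinRoot.root _ : CoverRing G) ∈ x.asHomogeneousIdeal.toIdeal := by
    refine Ideal.IsPrime.mem_of_pow_mem ‹_› 2 ?_
    rw [root_sq]
    exact hof 6 (by norm_num) _ G.2
  refine x.not_irrelevant_le ((HomogeneousIdeal.toIdeal_irrelevant_le _).mpr fun n hn y hy => ?_)
  induction hy using Submodule.span_induction with
  | zero => exact zero_mem _
  | add y z _ _ h h' => exact add_mem h h'
  | smul c y _ h =>
    rw [Algebra.smul_def]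
    exact Ideal.mul_mem_left _ _ h
  | mem y hy =>
    obtain ⟨m, j, rfl, a, ha, rfl⟩ := hy
    rcases Nat.eq_zero_or_pos j with rfl | hj
    · exact Ideal.mul_mem_right _ _ (hof m (by omega) a ha)
    · exact Ideal.mul_mem_left _ _ (Ideal.pow_mem_of_mem _ hW j hj)

/-- The standard affine cover of `Y_G` by the open subschemes `{Xᵢ ≠ 0}`. -/
noncomputable def coverCharts : (coverSurface G).AffineOpenCover where
  I₀ := Fin 3
  X i := .of (HomogeneousLocalization.Away (coverGrading G) (coverCoord G i))
  f i := Proj.awayι (coverGrading G) (coverCoord G i) (coverCoord_mem G i) Nat.one_pos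
  idx x := (TopologicalSpace.Opens.mem_iSup.mp
    ((iSup_basicOpen_coverCoord G).ge (Set.mem_univ x))).choose
  covers x := by
    change x ∈ (Proj.awayι (coverGrading G) _ _ _).opensRange
    rw [Proj.opensRange_awayι]
    exact (TopologicalSpace.Opens.mem_iSup.mp
      ((iSup_basicOpen_coverCoord G).ge (Set.mem_univ x))).choose_spec

/-- The projection of the chart `{Xᵢ ≠ 0}` of `Y_G` to the plane. -/
noncomputable def chartProj (i : Fin 3) :
    Spec (.of (HomogeneousLocalization.Away (coverGrading G) (coverCoord G i))) ⟶ P2 k :=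
  Spec.map (CommRingCat.ofHom
    (HomogeneousLocalization.Away.map (coordIncl G) (MvPolynomial.X i))) ≫ chartMap k i

lemma awayMap_comp_map (i j : Fin 3) {x : CoordRing k}
    (hx : x = MvPolynomial.X i * MvPolynomial.X j)
    (hx' : coordIncl G x = coverCoord G i * coverCoord G j) :
    (HomogeneousLocalization.awayMap (coverGrading G) (coverCoord_mem G j) hx').comp
      (HomogeneousLocalization.Away.map (coordIncl G) (MvPolynomial.X i)) =
    (HomogeneousLocalization.Away.map (coordIncl G) x).comp
      (HomogeneousLocalization.awayMap (Form k) (X_mem k j) hx) := by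
  subst hx
  refine RingHom.ext fun a => ?_
  obtain ⟨n, a, ha, rfl⟩ := HomogeneousLocalization.Away.mk_surjective (Form k) (X_mem k i) a
  rw [RingHom.comp_apply, RingHom.comp_apply, HomogeneousLocalization.Away.map_mk,
    HomogeneousLocalization.awayMap_mk, HomogeneousLocalization.awayMap_mk,
    HomogeneousLocalization.Away.map_mk]
  ext
  simp

lemma SpecMap_awayMap_chartProj (i j : Fin 3) {x : CoordRing k} (hx2 : x ∈ Form k 2)
    (hx : x = MvPolynomial.X i * MvPolynomial.X j)
    (hx' : coordIncl G x = coverCoord G i * coverCoord G j) :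
    Spec.map (CommRingCat.ofHom
      (HomogeneousLocalization.awayMap (coverGrading G) (coverCoord_mem G j) hx')) ≫
      chartProj G i =
    Spec.map (CommRingCat.ofHom (HomogeneousLocalization.Away.map (coordIncl G) x)) ≫
      Proj.awayι (Form k) x hx2 Nat.two_pos := by
  rw [chartProj, ← Category.assoc, ← Spec.map_comp, ← CommRingCat.ofHom_comp,
    awayMap_comp_map G i j hx hx', CommRingCat.ofHom_comp, Spec.map_comp, Category.assoc, chartMap,
    Proj.SpecMap_awayMap_awayι]

lemma chartProj_compat (i j : Fin 3) :
    pullback.fst ((coverCharts G).f i) ((coverCharts G).f j) ≫ chartProj G i =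
      pullback.snd ((coverCharts G).f i) ((coverCharts G).f j) ≫ chartProj G j := by
  have hx : coordIncl G (MvPolynomial.X i * MvPolynomial.X j) =
      coverCoord G i * coverCoord G j := map_mul (coordIncl G) _ _
  have hx2 : (MvPolynomial.X i * MvPolynomial.X j : CoordRing k) ∈ Form k 2 :=
    (X_mem k i).mul (X_mem k j)
  change pullback.fst (Proj.awayι _ _ (coverCoord_mem G i) Nat.one_pos)
      (Proj.awayι _ _ (coverCoord_mem G j) Nat.one_pos) ≫ _ =
    pullback.snd (Proj.awayι _ _ (coverCoord_mem G i) Nat.one_pos)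
      (Proj.awayι _ _ (coverCoord_mem G j) Nat.one_pos) ≫ _
  rw [← Proj.pullbackAwayιIso_hom_SpecMap_awayMap_left (coverGrading G) (coverCoord_mem G i)
      Nat.one_pos (coverCoord_mem G j) Nat.one_pos hx,
    ← Proj.pullbackAwayιIso_hom_SpecMap_awayMap_right (coverGrading G) (coverCoord_mem G i)
      Nat.one_pos (coverCoord_mem G j) Nat.one_pos hx, Category.assoc, Category.assoc,
    SpecMap_awayMap_chartProj G i j hx2 rfl hx,
    SpecMap_awayMap_chartProj G j i hx2 (mul_comm _ _) (hx.trans (mul_comm _ _))]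

/-- The double cover `π_G : Y_G ⟶ ℙ²`, induced by `k[X₀, X₁, X₂] → k[X₀, X₁, X₂][W] / (W² - G)`. -/
noncomputable def coverProj : coverSurface G ⟶ P2 k :=
  (coverCharts G).openCover.glueMorphisms (chartProj G) (chartProj_compat G)

end Cover

section Nodes

/-- A local ring with residue field `k` is an ordinary node (a rational double point of type `A₁`)
of a surface if its completion is isomorphic, as a ring, to
`k[[x, y, z]] / (xy - z²)`. -/
def IsOrdinaryNode (k R : Type*) [Field k] [CommRing R] [IsLocalRing R] : Prop :=
  Nonempty (AdicCompletion (IsLocalRing.maximalIdeal R) R ≃+*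
    (MvPowerSeries (Fin 3) k ⧸ Ideal.span
      {(MvPowerSeries.X 0 * MvPowerSeries.X 1 - MvPowerSeries.X 2 ^ 2 :
        MvPowerSeries (Fin 3) k)}))

/-- The singular points of a scheme: the points at which the local ring is not regular. -/
def singularPoints (Y : Scheme.{u}) : Set Y :=
  {y | ¬ IsRegularLocalRing (Y.presheaf.stalk y)}

/-- The locus `𝒰` of the nonzero sextic forms `G` such that the surface `Y_G` has `21` ordinary
nodes as its only singularities. -/
def nodalLocus (k : Type u) [Field k] : Set (Form k 6) :=
  {G | G ≠ 0 ∧ (singularPoints (coverSurface G)).ncard = 21 ∧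
    ∀ y ∈ singularPoints (coverSurface G),
      IsOrdinaryNode k ((coverSurface G).presheaf.stalk y)}

end Nodes

end PlaneDoubleCover

namespace PlaneDoubleCover

/-! ### Syzygies of a vector of forms orthogonal to the coordinates -/

section Syzygies

/-! Both equivalences go through condition (iii). As `2 = 0`, the substitution `W ↦ d W + H` turns
`W²` into `d² G + H²`, so with `c = d²` it identifies the two covers over the plane (`coverHom`).
Conversely, over the chart `X₀ ≠ 0` the cover is free over the chart ring on `1` and `w = W / X₀³`,
so an isomorphism over the plane sends `w'` to `α + β w`. Squaring gives `g' = β² g + α²` for the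
dehomogenized sextics, and invertibility makes `β` a unit of a polynomial ring, hence a constant
(`exists_dehomogenize_eq`). Then `G' - β² G` is a square on the chart, and therefore the square of a
cubic form (`exists_eq_sq_of_frac_eq_sq`).

(iii) gives (ii) because `d(c G + H²) = c dG`. For the converse, `dG` has to be recovered up to a
scalar from its zeros. By Euler's formula and `6 = 0`, the gradient `g` of `G` is orthogonal to `X =
(X₀, X₁, X₂)`, so `g = X × a` by exactness of the Koszul complex. A common factor of the entries of
`g` would make `dG` vanish along a curve; over each point of it the surface has a tangent space of
dimension three, against the finiteness of the singular set (`exists_not_dvd_pderiv`). Without a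
common factor, the syzygies of `g` are generated by `X` and `a`, as in the Hilbert–Burch theorem,
and the ideal of the entries of `g` is saturated (`mem_span_of_X_pow_mul_mem`).

If the zero schemes agree, saturation and a comparison of degrees give `g' = M g` with a constant
matrix `M`. Now `Mᵀ X` is a linear syzygy of `g`. Its cross product with `X` is quadratic and a
multiple of the quintic vector `g`, hence zero, and so `M` is a scalar `c` (`exists_eq_C_mul`).
Finally `G' - c G` has zero gradient, which over a perfect field of characteristic two makes it a
square (`exists_eq_sq_of_pderiv_eq_zero`); and `c ≠ 0` since `dG' ≠ 0`. -/

lemma cross_comm {R : Type*} [CommRing R] {g w : Fin 3 → R} (h01 : g 0 * w 1 = g 1 * w 0)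
    (h02 : g 0 * w 2 = g 2 * w 0) (h12 : g 1 * w 2 = g 2 * w 1) (i j : Fin 3) :
    g i * w j = g j * w i := by
  match i, j with
  | 0, 0 | 1, 1 | 2, 2 => rfl
  | 0, 1 => exact h01
  | 1, 0 => exact h01.symm
  | 0, 2 => exact h02
  | 2, 0 => exact h02.symm
  | 1, 2 => exact h12
  | 2, 1 => exact h12.symm

/-- If the vectors `g` and `w` are proportional and no prime divides all entries of `g`, then `w` is
a multiple of `g`. -/
lemma exists_eq_mul_of_cross_eq_zero {R : Type*} [CommRing R] [IsDomain R]
    [UniqueFactorizationMonoid R] (g w : Fin 3 → R) (h0 : g ≠ 0)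
    (hg : ∀ p : R, Prime p → ∃ i, ¬ p ∣ g i)
    (h : ∀ i j, g i * w j = g j * w i) : ∃ r, ∀ i, w i = r * g i := by
  classical
  obtain ⟨i, hi⟩ := Function.ne_iff.mp h0
  simp only [Pi.zero_apply] at hi
  let := UniqueFactorizationMonoid.toGCDMonoid R
  have hd : IsUnit (gcd (gcd (g 0) (g 1)) (g 2)) := by
    by_contra hu
    have hdiv : ∀ j, gcd (gcd (g 0) (g 1)) (g 2) ∣ g j := by
      intro j
      fin_cases j
      · exact (gcd_dvd_left _ _).trans (gcd_dvd_left _ _)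
      · exact (gcd_dvd_left _ _).trans (gcd_dvd_right _ _)
      · exact gcd_dvd_right _ _
    have hne : gcd (gcd (g 0) (g 1)) (g 2) ≠ 0 := fun h => hi (by simpa [h] using hdiv i)
    obtain ⟨p, hp, hpd⟩ := WfDvdMonoid.exists_irreducible_factor hu hne
    obtain ⟨j, hj⟩ := hg p hp.prime
    exact hj (hpd.trans (hdiv j))
  -- Proportionality shows that `g i` divides every `g j * w i`, hence also `gcd(g) * w i`, where
  -- the gcd is a unit.
  have hdvd : g i ∣ w i := by
    have hj : ∀ j, g i ∣ g j * w i := fun j => ⟨w j, (h i j).symm⟩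
    have h1 : g i ∣ gcd (gcd (g 0) (g 1)) (g 2) * w i := by
      refine (dvd_gcd ((dvd_gcd (hj 0) (hj 1)).trans (gcd_mul_right' _ _ _).dvd) (hj 2)).trans ?_
      exact (gcd_mul_right' _ _ _).dvd
    exact (IsUnit.dvd_mul_left hd).mp h1
  obtain ⟨r, hr⟩ := hdvd
  refine ⟨r, fun j => mul_left_cancel₀ hi ?_⟩
  rw [h i j, hr]
  ring

variable {k : Type*} [Field k]

open MvPolynomial

/-- Membership in a monomial ideal is tested on the support, which multiplication by `X i` only
shifts in direction `i`. So `X i` is a nonzerodivisor modulo the other variables: the variables form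
a regular sequence. -/
lemma mem_span_X_of_mul {s : Set (Fin 3)} {i : Fin 3} (hi : i ∉ s) {v : CoordRing k}
    (h : X i * v ∈ Ideal.span (X '' s : Set (CoordRing k))) :
    v ∈ Ideal.span (X '' s : Set (CoordRing k)) := by
  rw [mem_ideal_span_X_image] at h ⊢
  intro m hm
  have hm' : Finsupp.single i 1 + m ∈ (X i * v).support := by
    rw [mem_support_iff, coeff_X_mul]
    exact mem_support_iff.mp hm
  obtain ⟨j, hj, hne⟩ := h _ hm'
  refine ⟨j, hj, ?_⟩
  have : i ≠ j := fun e => hi (e ▸ hj)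
  simpa [Finsupp.single_apply, this] using hne

/-- Exactness of the Koszul complex of the three variables in the middle. -/
lemma koszul_exact {v : Fin 3 → CoordRing k} (h : X 0 * v 0 + X 1 * v 1 + X 2 * v 2 = 0) :
    ∃ a : Fin 3 → CoordRing k, v 0 = X 1 * a 2 - X 2 * a 1 ∧ v 1 = X 2 * a 0 - X 0 * a 2 ∧
      v 2 = X 0 * a 1 - X 1 * a 0 := by
  have h0 : v 0 ∈ Ideal.span (X '' ({1, 2} : Set (Fin 3)) : Set (CoordRing k)) := by
    refine mem_span_X_of_mul (i := 0) (by simp) ?_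
    rw [Set.image_pair, Ideal.mem_span_pair]
    exact ⟨-v 1, -v 2, by linear_combination -h⟩
  rw [Set.image_pair, Ideal.mem_span_pair] at h0
  obtain ⟨p, q, hpq⟩ := h0
  have h1 : v 1 + X 0 * p ∈ Ideal.span (X '' ({2} : Set (Fin 3)) : Set (CoordRing k)) := by
    refine mem_span_X_of_mul (i := 1) (by simp) ?_
    rw [Set.image_singleton, Ideal.mem_span_singleton]
    exact ⟨-v 2 - X 0 * q, by linear_combination h + X 0 * hpq⟩
  rw [Set.image_singleton, Ideal.mem_span_singleton] at h1
  obtain ⟨r, hr⟩ := h1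
  refine ⟨![r, -q, p], ?_, ?_, ?_⟩
  · simp only [Matrix.cons_val]
    linear_combination -hpq
  · simp only [Matrix.cons_val]
    linear_combination hr
  · simp only [Matrix.cons_val]
    refine mul_left_cancel₀ (X_ne_zero (R := k) (2 : Fin 3)) ?_
    linear_combination h + X 0 * hpq - X 1 * hr

lemma X_not_dvd_X {i j : Fin 3} (h : i ≠ j) : ¬ (X i : CoordRing k) ∣ X j := by
  rw [X_dvd_X]
  simpa using h

lemma cross_X_eq_zero {v : Fin 3 → CoordRing k} (h : ∀ i j, X i * v j = X j * v i) :
    ∃ r, ∀ i, v i = r * X i := by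
  refine exists_eq_mul_of_cross_eq_zero X v ?_ ?_ h
  · exact fun h => X_ne_zero (R := k) (0 : Fin 3) (congrFun h 0)
  · intro p hp
    by_contra! H
    have h0 := (hp.irreducible.dvd_irreducible_iff_associated
      (X_prime (R := k) (i := (0 : Fin 3))).irreducible).mp (H 0)
    exact X_not_dvd_X (k := k) (i := 0) (j := 1) (by decide) (h0.symm.dvd.trans (H 1))

lemma homogeneousComponent_mul_eq {σ S : Type*} [CommRing S] {a b : MvPolynomial σ S} {i n : ℕ}
    (hb : b.IsHomogeneous i) (h : i ≤ n) :
    homogeneousComponent n (a * b) = homogeneousComponent (n - i) a * b := by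
  let := gradedAlgebra (σ := σ) (R := S)
  have := DirectSum.coe_decompose_mul_of_right_mem_of_le (homogeneousSubmodule σ S) (a := a) hb h
  erw [decomposition.decompose'_apply, decomposition.decompose'_apply] at this
  exact this

lemma homogeneousComponent_mul_eq_zero {σ S : Type*} [CommRing S] {a b : MvPolynomial σ S}
    {i n : ℕ} (hb : b.IsHomogeneous i) (h : ¬ i ≤ n) : homogeneousComponent n (a * b) = 0 := by
  let := gradedAlgebra (σ := σ) (R := S)
  have := DirectSum.coe_decompose_mul_of_right_mem_of_not_le (homogeneousSubmodule σ S) (a := a) hb h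
  erw [decomposition.decompose'_apply] at this
  exact this

variable {g : Fin 3 → CoordRing k} (h0 : g ≠ 0) (hg : ∀ p : CoordRing k, Prime p → ∃ i, ¬ p ∣ g i)

include h0 hg

/-- The vectors orthogonal to `g`, where `g` is orthogonal to `X`: their cross products with `X` are
multiples of `g`. -/
lemma exists_cross_X_eq_mul
    (hX : (X 0 : CoordRing k) * g 0 + (X 1 : CoordRing k) * g 1 +
      (X 2 : CoordRing k) * g 2 = 0) {s : Fin 3 → CoordRing k}
    (hs : s 0 * g 0 + s 1 * g 1 + s 2 * g 2 = 0) :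
    ∃ r, s 1 * X 2 - s 2 * X 1 = r * g 0 ∧ s 2 * X 0 - s 0 * X 2 = r * g 1 ∧
      s 0 * X 1 - s 1 * X 0 = r * g 2 := by
  obtain ⟨r, hr⟩ := exists_eq_mul_of_cross_eq_zero g
    ![s 1 * X 2 - s 2 * X 1, s 2 * X 0 - s 0 * X 2, s 0 * X 1 - s 1 * X 0] h0 hg (by
      have h01 : g 0 * (s 2 * X 0 - s 0 * X 2) = g 1 * (s 1 * X 2 - s 2 * X 1) := by
        linear_combination s 2 * hX - X 2 * hs
      have h02 : g 0 * (s 0 * X 1 - s 1 * X 0) = g 2 * (s 1 * X 2 - s 2 * X 1) := by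
        linear_combination X 1 * hs - s 1 * hX
      have h12 : g 1 * (s 0 * X 1 - s 1 * X 0) = g 2 * (s 2 * X 0 - s 0 * X 2) := by
        linear_combination s 0 * hX - X 0 * hs
      exact cross_comm h01 h02 h12)
  exact ⟨r, hr 0, hr 1, hr 2⟩

/-- The syzygies of `g = X × a` are generated by `X` and `a`. -/
lemma exists_syzygy {a : Fin 3 → CoordRing k} (ha0 : g 0 = X 1 * a 2 - X 2 * a 1)
    (ha1 : g 1 = X 2 * a 0 - X 0 * a 2) (ha2 : g 2 = X 0 * a 1 - X 1 * a 0) {s : Fin 3 → CoordRing k}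
    (hs : s 0 * g 0 + s 1 * g 1 + s 2 * g 2 = 0) :
    ∃ p q, ∀ i, s i = p * X i + q * a i := by
  have hX : (X 0 : CoordRing k) * g 0 + (X 1 : CoordRing k) * g 1 + (X 2 : CoordRing k) * g 2 =
      0 := by rw [ha0, ha1, ha2]; ring
  obtain ⟨r, hr0, hr1, hr2⟩ := exists_cross_X_eq_mul h0 hg hX hs
  obtain ⟨p, hp⟩ := cross_X_eq_zero (v := fun i => s i + r * a i) (by
    have h01 : X 0 * (s 1 + r * a 1) = X 1 * (s 0 + r * a 0) := by
      linear_combination -hr2 - r * ha2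
    have h02 : X 0 * (s 2 + r * a 2) = X 2 * (s 0 + r * a 0) := by
      linear_combination hr1 + r * ha1
    have h12 : X 1 * (s 2 + r * a 2) = X 2 * (s 1 + r * a 1) := by
      linear_combination -hr0 - r * ha0
    exact cross_comm h01 h02 h12)
  exact ⟨p, -r, fun i => by linear_combination hp i⟩

/-- The ideal generated by the entries of `g` has no socle. -/
lemma mem_span_of_X_mul_mem
    (hX : (X 0 : CoordRing k) * g 0 + (X 1 : CoordRing k) * g 1 +
      (X 2 : CoordRing k) * g 2 = 0) {u : CoordRing k}
    (hu : ∀ i, X i * u ∈ Ideal.span (Set.range g)) : u ∈ Ideal.span (Set.range g) := by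
  obtain ⟨a, ha0, ha1, ha2⟩ := koszul_exact hX
  simp only [Ideal.mem_span_range_iff_exists_fun, Fin.sum_univ_three] at hu ⊢
  choose b hb using hu
  -- Two expressions of `X i * X j * u` through `g` differ by a syzygy, hence by a combination of
  -- `X` and `a`.
  have hsyz : ∀ i j, ∃ p q, ∀ l, X j * b i l - X i * b j l = p * X l + q * a l := by
    intro i j
    refine exists_syzygy h0 hg ha0 ha1 ha2 ?_
    linear_combination X j * hb i - X i * hb j
  obtain ⟨p₂, q₂, h₂⟩ := hsyz 0 1
  obtain ⟨p₀, q₀, h₀⟩ := hsyz 1 2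
  obtain ⟨p₁, q₁, h₁⟩ := hsyz 2 0
  -- The cyclic sum of the differences `X j * b i - X i * b j` cancels. As `X × a = g ≠ 0`, the
  -- vectors `X` and `a` are independent, so both coefficients vanish.
  have hrel : ∀ l, (X 0 * p₀ + X 1 * p₁ + X 2 * p₂) * X l +
      (X 0 * q₀ + X 1 * q₁ + X 2 * q₂) * a l = 0 := by
    intro l
    linear_combination - X 2 * h₂ l - X 0 * h₀ l - X 1 * h₁ l
  have hq : X 0 * q₀ + X 1 * q₁ + X 2 * q₂ = 0 := by
    by_contra hne
    refine h0 (funext fun i => mul_left_cancel₀ hne ?_)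
    rw [Pi.zero_apply, mul_zero]
    fin_cases i <;> simp only [Fin.zero_eta, Fin.mk_one, Fin.reduceFinMk]
    · rw [ha0]; linear_combination X 1 * hrel 2 - X 2 * hrel 1
    · rw [ha1]; linear_combination X 2 * hrel 0 - X 0 * hrel 2
    · rw [ha2]; linear_combination X 0 * hrel 1 - X 1 * hrel 0
  have hp : X 0 * p₀ + X 1 * p₁ + X 2 * p₂ = 0 := by
    have := hrel 0
    rw [hq, zero_mul, add_zero] at this
    exact (mul_eq_zero.mp this).resolve_right (X_ne_zero _)
  -- Koszul exactness makes `p` and `q` coboundaries. Correcting each `b i` by the syzygy `P i * X +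
  -- Q i * a` makes the rows compatible, so that row `0` is divisible by `X 0`; the quotient
  -- expresses `u` itself.
  obtain ⟨P, hP0, hP1, hP2⟩ := koszul_exact (v := ![p₀, p₁, p₂]) hp
  obtain ⟨Q, hQ0, hQ1, hQ2⟩ := koszul_exact (v := ![q₀, q₁, q₂]) hq
  simp only [Matrix.cons_val] at hP0 hP1 hP2 hQ0 hQ1 hQ2
  have hdiv : ∀ l, (X 0 : CoordRing k) ∣ b 0 l + P 0 * X l + Q 0 * a l := by
    intro l
    have h1 : X 1 * (b 0 l + P 0 * X l + Q 0 * a l) =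
        X 0 * (b 1 l + P 1 * X l + Q 1 * a l) := by
      linear_combination h₂ l + X l * hP2 + a l * hQ2
    exact ((X_prime (R := k) (i := (0 : Fin 3))).dvd_or_dvd ⟨_, h1⟩).resolve_left
      (X_not_dvd_X (by decide))
  choose e he using hdiv
  refine ⟨e, mul_left_cancel₀ (X_ne_zero (R := k) (0 : Fin 3)) ?_⟩
  have hag : a 0 * g 0 + a 1 * g 1 + a 2 * g 2 =
      0 := by rw [ha0, ha1, ha2]; ring
  linear_combination hb 0 - he 0 * g 0 - he 1 * g 1 - he 2 * g 2 + P 0 * hX + Q 0 * hag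

/-- The ideal generated by the entries of `g` is saturated. -/
lemma mem_span_of_X_pow_mul_mem
    (hX : (X 0 : CoordRing k) * g 0 + (X 1 : CoordRing k) * g 1 +
      (X 2 : CoordRing k) * g 2 = 0) {u : CoordRing k}
    (hu : ∀ i, ∃ n : ℕ, X i ^ n * u ∈ Ideal.span (Set.range g)) :
    u ∈ Ideal.span (Set.range g) := by
  set J := Ideal.span (Set.range g)
  set m : Ideal (CoordRing k) := Ideal.span (Set.range X)
  have hrad : m ≤ (J.colon {u}).radical := by
    rw [Ideal.span_le]
    rintro _ ⟨i, rfl⟩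
    obtain ⟨n, hn⟩ := hu i
    exact ⟨n, Submodule.mem_colon_singleton.mpr hn⟩
  obtain ⟨n, hn⟩ := Ideal.exists_pow_le_of_le_radical_of_fg hrad
    (Submodule.fg_span (Set.finite_range _))
  -- Each step lowers the power of `m` by one, because `J` has no socle.
  have hind : ∀ n : ℕ, (∀ t ∈ m ^ n, t * u ∈ J) → u ∈ J := by
    intro n
    induction n with
    | zero => intro h; simpa using h 1 (by simp)
    | succ n ih =>
      refine fun h => ih fun t ht => mem_span_of_X_mul_mem h0 hg hX fun i => ?_
      rw [← mul_assoc]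
      exact h _ (by rw [pow_succ']; exact Ideal.mul_mem_mul (Ideal.subset_span ⟨i, rfl⟩) ht)
  exact hind n fun t ht => Submodule.mem_colon_singleton.mp (hn ht)

/-- The section of `Ω¹(6)` given by `g` is determined up to a scalar by its zero scheme. -/
lemma exists_eq_C_mul
    (hX : (X 0 : CoordRing k) * g 0 + (X 1 : CoordRing k) * g 1 +
      (X 2 : CoordRing k) * g 2 = 0)
    (hdeg : ∀ i, (g i).IsHomogeneous 5) {g' : Fin 3 → CoordRing k}
    (hX' : (X 0 : CoordRing k) * g' 0 + (X 1 : CoordRing k) * g' 1 +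
      (X 2 : CoordRing k) * g' 2 = 0) (hdeg' : ∀ i, (g' i).IsHomogeneous 5)
    (h : ∀ i j, ∃ n : ℕ, X i ^ n * g' j ∈ Ideal.span (Set.range g)) :
    ∃ c : k, ∀ i, g' i = C c * g i := by
  have hmem : ∀ j, ∃ M : Fin 3 → k, g' j = C (M 0) * g 0 + C (M 1) * g 1 + C (M 2) * g 2 := by
    intro j
    have := mem_span_of_X_pow_mul_mem h0 hg hX fun i => h i j
    rw [Ideal.mem_span_range_iff_exists_fun] at this
    obtain ⟨c, hc⟩ := this
    -- All entries of `g` and `g'` are quintic, so in degree five only the constant terms of the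
    -- coefficients contribute.
    refine ⟨fun l => coeff 0 (c l), ?_⟩
    have h1 := congrArg (homogeneousComponent 5) hc
    rw [map_sum, homogeneousComponent_of_mem (hdeg' j), if_pos rfl] at h1
    rw [← h1, Fin.sum_univ_three]
    simp only [homogeneousComponent_mul_eq (hdeg _) le_rfl, Nat.sub_self, homogeneousComponent_zero]
  choose M hM using hmem
  -- This is `(Mᵀ X) · g = X · (M g) = X · g' = 0`.
  have hsyz : (C (M 0 0) * X 0 + C (M 1 0) * X 1 + C (M 2 0) * X 2) * g 0 +
      (C (M 0 1) * X 0 + C (M 1 1) * X 1 + C (M 2 1) * X 2) * g 1 +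
      (C (M 0 2) * X 0 + C (M 1 2) * X 1 + C (M 2 2) * X 2) * g 2 = 0 := by
    linear_combination hX' - X 0 * hM 0 - X 1 * hM 1 - X 2 * hM 2
  set s : Fin 3 → CoordRing k := fun l => C (M 0 l) * X 0 + C (M 1 l) * X 1 + C (M 2 l) * X 2 with hs
  have hs1 : ∀ l, (s l).IsHomogeneous 1 := fun l =>
    (((isHomogeneous_X k _).C_mul _).add ((isHomogeneous_X k _).C_mul _)).add
      ((isHomogeneous_X k _).C_mul _)
  obtain ⟨r, hr0, hr1, hr2⟩ := exists_cross_X_eq_mul h0 hg hX (s := s) hsyz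
  have hquad : ∀ i j, (s i * X j - s j * X i).IsHomogeneous 2 := fun i j =>
    ((hs1 i).mul (isHomogeneous_X k j)).sub ((hs1 j).mul (isHomogeneous_X k i))
  -- A multiple of a quintic has no component of degree two.
  have hvan : ∀ (q : CoordRing k) (i : Fin 3), q.IsHomogeneous 2 → q = r * g i → q = 0 := by
    intro q i hq h1
    have h2 := congrArg (homogeneousComponent 2) h1
    rwa [homogeneousComponent_of_mem hq, if_pos rfl,
      homogeneousComponent_mul_eq_zero (hdeg i) (by norm_num)] at h2
  have e0 := hvan _ _ (hquad 1 2) hr0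
  have e1 := hvan _ _ (hquad 2 0) hr1
  have e2 := hvan _ _ (hquad 0 1) hr2
  obtain ⟨t, ht⟩ := cross_X_eq_zero (v := s) (by
    have h01 : X 0 * s 1 = X 1 * s 0 := by linear_combination -e2
    have h02 : X 0 * s 2 = X 2 * s 0 := by linear_combination e1
    have h12 : X 1 * s 2 = X 2 * s 1 := by linear_combination -e0
    exact cross_comm h01 h02 h12)
  refine ⟨coeff 0 t, ?_⟩
  have hco : ∀ l m, M m l = if m = l then coeff 0 t else 0 := by
    intro l m
    have := congrArg (coeff (Finsupp.single m 1)) (ht l)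
    rw [coeff_mul_X'] at this
    fin_cases l <;> fin_cases m <;>
      simpa [hs, coeff_C_mul, coeff_X, Finsupp.single_left_inj] using this
  intro i
  rw [hM i]
  fin_cases i <;> simp [hco]

end Syzygies

/-! ### Forms: square roots, factors and infinitely many zeros -/

section Forms

open MvPolynomial

variable {k : Type*} [Field k]

lemma eval₂_mul_of_isHomogeneous {σ S T : Type*} [CommRing S] [CommRing T] {n : ℕ}
    {F : MvPolynomial σ S} (hF : F.IsHomogeneous n) (f : S →+* T) (c : T) (a : σ → T) :
    eval₂ f (fun i => c * a i) F = c ^ n * eval₂ f a F := by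
  rw [eval₂_eq, eval₂_eq, Finset.mul_sum]
  refine Finset.sum_congr rfl fun d hd => ?_
  have hdm : ∑ i ∈ d.support, d i = n := (hF.degree_eq_sum_deg_support hd).symm
  simp only [mul_pow, Finset.prod_mul_distrib]
  rw [Finset.prod_pow_eq_pow_sum, hdm]
  ring

/-- In characteristic two, a form of even degree over a perfect field all of whose partial
derivatives vanish is a square. -/
lemma exists_eq_sq_of_pderiv_eq_zero {σ : Type*} [CharP k 2] [PerfectRing k 2] {n : ℕ}
    {F : MvPolynomial σ k} (hF : F.IsHomogeneous (2 * n)) (h : ∀ i, pderiv i F = 0) :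
    ∃ H : MvPolynomial σ k, H.IsHomogeneous n ∧ F = H ^ 2 := by
  classical
  -- An odd exponent `m i` is a nonzero scalar, so the monomial `m` would survive in the `i`-th
  -- partial derivative.
  have heven : ∀ m ∈ F.support, ∀ i, 2 ∣ m i := by
    intro m hm i
    by_contra hi
    have h0 : m i ≠ 0 := by rintro h0; simp [h0] at hi
    have hm' : m - Finsupp.single i 1 + Finsupp.single i 1 = m :=
      tsub_add_cancel_of_le (by simpa [Nat.one_le_iff_ne_zero] using h0)
    have h1 := congrArg (coeff (m - Finsupp.single i 1)) (h i)
    rw [coeff_pderiv, hm', coeff_zero, mul_eq_zero] at h1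
    refine h1.elim (mem_support_iff.mp hm) fun h2 => hi ?_
    rw [← CharP.cast_eq_zero_iff k 2]
    have h3 : (m - Finsupp.single i 1 : σ →₀ ℕ) i + 1 = m i := by
      simp; omega
    rw [← h3]
    exact_mod_cast h2
  have hhalf : ∀ m ∈ F.support, ∃ m' : σ →₀ ℕ, m = 2 • m' := by
    intro m hm
    refine ⟨m.mapRange (· / 2) rfl, Finsupp.ext fun i => ?_⟩
    simp [Nat.mul_div_cancel' (heven m hm i)]
  choose! d hd using hhalf
  refine ⟨∑ m ∈ F.support, monomial (d m) ((frobeniusEquiv k 2).symm (coeff m F)), ?_, ?_⟩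
  · refine IsHomogeneous.sum _ _ _ fun m hm => isHomogeneous_monomial _ ?_
    have h1 := hF.degree_eq_sum_deg_support hm
    have h2 : m.degree = 2 * (d m).degree := by
      conv_lhs => rw [hd m hm]
      simp
    have h3 : m.degree = 2 * n := by
      rw [h1]; rfl
    omega
  · rw [sum_pow_char]
    conv_lhs => rw [F.as_sum]
    refine Finset.sum_congr rfl fun m hm => ?_
    rw [monomial_pow, ← hd m hm]
    congr 1
    exact ((frobeniusEquiv k 2).apply_symm_apply _).symm

/-- A factor of a nonzero form is a form. -/
lemma exists_isHomogeneous_of_dvd {σ : Type*} {n : ℕ} {p F : MvPolynomial σ k}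
    (hF : F.IsHomogeneous n) (h0 : F ≠ 0) (h : p ∣ F) : ∃ e, p.IsHomogeneous e := by
  classical
  obtain ⟨q, rfl⟩ := h
  -- `φ f = f(tX)` records degrees as powers of `t`. If a product of two polynomials is a monomial
  -- in `t`, then each factor has equal degree and trailing degree.
  let φ : MvPolynomial σ k →ₐ[k] Polynomial (MvPolynomial σ k) :=
    aeval fun i => Polynomial.C (X i) * Polynomial.X
  have hφ : ∀ (m : ℕ) (f : MvPolynomial σ k), f.IsHomogeneous m →
      φ f = Polynomial.monomial m f := by
    intro m f hf
    have h1 : φ f = Polynomial.X ^ m * aeval (fun i => Polynomial.C (X i)) f := by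
      simp only [φ, mul_comm (Polynomial.C _), aeval_def]
      exact eval₂_mul_of_isHomogeneous hf _ _ _
    have h2 : aeval (fun i => Polynomial.C (X i)) f = Polynomial.C f := by
      have : aeval (fun i => Polynomial.C (X i)) =
          (Polynomial.CAlgHom : MvPolynomial σ k →ₐ[MvPolynomial σ k] _).restrictScalars k := by
        ext i; simp
      rw [this]; rfl
    rw [h1, h2, mul_comm, Polynomial.C_mul_X_pow_eq_monomial]
  have hsum : ∀ f : MvPolynomial σ k, ∀ m, (φ f).coeff m = homogeneousComponent m f := by
    intro f m
    conv_lhs => rw [← sum_homogeneousComponent f, map_sum]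
    rw [Polynomial.finsetSum_coeff]
    simp only [hφ _ _ (homogeneousComponent_isHomogeneous _ _), Polynomial.coeff_monomial]
    rw [Finset.sum_ite_eq']
    split_ifs with hm
    · rfl
    · rw [homogeneousComponent_eq_zero]
      simpa using hm
  have hmul : φ p * φ q = Polynomial.monomial n (p * q) := by rw [← map_mul, hφ _ _ hF]
  have hne : φ p * φ q ≠ 0 := by
    rw [hmul]; simpa using h0
  have hp := left_ne_zero_of_mul hne
  have hq := right_ne_zero_of_mul hne
  have h1 : (φ p).natDegree + (φ q).natDegree = n := by
    rw [← Polynomial.natDegree_mul hp hq, hmul, Polynomial.natDegree_monomial_eq _ h0]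
  have h2 : (φ p).natTrailingDegree + (φ q).natTrailingDegree = n := by
    rw [← Polynomial.natTrailingDegree_mul hp hq, hmul, Polynomial.natTrailingDegree_monomial h0]
  have h3 := (φ p).natTrailingDegree_le_natDegree
  have h4 := (φ q).natTrailingDegree_le_natDegree
  refine ⟨(φ p).natDegree, ?_⟩
  have h5 : p = homogeneousComponent (φ p).natDegree p := by
    conv_lhs => rw [← sum_homogeneousComponent p]
    refine Finset.sum_eq_single _ (fun m _ hm => ?_) fun hm => ?_
    · rw [← hsum]
      rcases lt_or_gt_of_ne hm with hlt | hgt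
      · exact Polynomial.coeff_eq_zero_of_lt_natTrailingDegree (by omega)
      · exact Polynomial.coeff_eq_zero_of_natDegree_lt hgt
    · exact homogeneousComponent_eq_zero _ _ (by simpa using hm)
  have h6 := homogeneousComponent_isHomogeneous (φ p).natDegree p
  rwa [← h5] at h6

/-- A point other than `Q` on the line through `Q` and `b` at which a form vanishes. -/
lemma exists_eval_eq_zero_on_line [IsAlgClosed k] {e : ℕ} (he : e ≠ 0) {p : CoordRing k}
    (hp : p.IsHomogeneous e) {Q : Fin 3 → k} (b : Fin 3 → k) (hQ : eval Q p ≠ 0) :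
    ∃ α β : k, β ≠ 0 ∧ eval (fun i => α * Q i + β * b i) p = 0 := by
  have hsmul : ∀ (c : k) (a : Fin 3 → k), eval (fun i => c * a i) p = c ^ e * eval a p := by
    intro c a
    exact eval₂_mul_of_isHomogeneous hp (RingHom.id k) c a
  let h : Polynomial k := aeval (fun i => Polynomial.C (Q i) + Polynomial.C (b i) * Polynomial.X) p
  have heval : ∀ u, h.eval u = eval (fun i => Q i + u * b i) p := by
    intro u
    rw [← Polynomial.coe_aeval_eq_eval]
    simp only [h]
    rw [← AlgHom.comp_apply, comp_aeval]
    rw [← coe_aeval_eq_eval]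
    simp only [map_add, map_mul, Polynomial.aeval_C, Polynomial.aeval_X, mul_comm]
    rfl
  -- A nonconstant `h` has a root, which is not `0` as `p` does not vanish at `Q`. If `h` is
  -- constant, reversing the parametrization gives `p(b + u Q) = h.coeff 0 * u ^ e`, which vanishes
  -- at `u = 0`, so at `b` itself.
  by_cases hdeg : h.degree = 0
  · have hc : ∀ u, eval (fun i => Q i + u * b i) p = h.coeff 0 := by
      intro u
      rw [← heval, Polynomial.eq_C_of_degree_eq_zero hdeg]
      simp
    let h' : Polynomial k :=
      aeval (fun i => Polynomial.C (b i) + Polynomial.C (Q i) * Polynomial.X) p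
    have heval' : ∀ u, h'.eval u = eval (fun i => b i + u * Q i) p := by
      intro u
      rw [← Polynomial.coe_aeval_eq_eval]
      simp only [h']
      rw [← AlgHom.comp_apply, comp_aeval]
      rw [← coe_aeval_eq_eval]
      simp only [map_add, map_mul, Polynomial.aeval_C, Polynomial.aeval_X, mul_comm]
      rfl
    have hh : h' = Polynomial.C (h.coeff 0) * Polynomial.X ^ e := by
      refine Polynomial.eq_of_infinite_eval_eq _ _ ?_
      refine (Set.finite_singleton (0 : k)).infinite_compl.mono fun u hu => ?_
      have hu0 : u ≠ 0 := hu
      simp only [Set.mem_ofPred_eq, heval', Polynomial.eval_mul, Polynomial.eval_C,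
        Polynomial.eval_pow, Polynomial.eval_X]
      rw [← hc u⁻¹, mul_comm, ← hsmul]
      congr 2
      funext i
      field_simp
      ring
    refine ⟨0, 1, one_ne_zero, ?_⟩
    have := heval' 0
    rw [hh] at this
    simpa [he] using this.symm
  · have : h.degree ≠ 0 := hdeg
    obtain ⟨u, hu⟩ := IsAlgClosed.exists_root h this
    have huQ : eval (fun i => Q i + u * b i) p = 0 := by rw [← heval]; exact hu
    refine ⟨1, u, ?_, by simpa using huQ⟩
    rintro rfl
    simp at huQ
    exact hQ huQ

/-- A plane curve has infinitely many points. -/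
lemma exists_infinite_zeros [IsAlgClosed k] {e : ℕ} (he : e ≠ 0) {p : CoordRing k}
    (hp : p.IsHomogeneous e) (h0 : p ≠ 0) :
    ∃ i, {a : Fin 3 → k | a i = 1 ∧ eval a p = 0}.Infinite := by
  by_contra! H
  have hinf : Infinite k := IsAlgClosed.instInfinite
  obtain ⟨Q, hQ⟩ : ∃ Q : Fin 3 → k, eval Q p ≠ 0 := by
    by_contra! h
    exact h0 (MvPolynomial.funext (by simpa using h))
  obtain ⟨i, hi⟩ : ∃ i, Q i ≠ 0 := by
    by_contra! h
    refine hQ ?_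
    have : Q = fun i => 0 * Q i := by ext j; simp [h j]
    rw [this]
    refine (eval₂_mul_of_isHomogeneous hp (RingHom.id k) 0 Q).trans ?_
    simp [he]
  have h1 : i ≠ i + 1 := (by decide : ∀ i : Fin 3, i ≠ i + 1) i
  have h2 : i ≠ i + 2 := (by decide : ∀ i : Fin 3, i ≠ i + 2) i
  have h3 : i + 1 ≠ i + 2 := (by decide : ∀ i : Fin 3, i + 1 ≠ i + 2) i
  -- Projection from the point `Q` off the curve: `ρ a` is the slope of the line through `Q` and
  -- `a`, unchanged by rescaling `a`. Every line through `Q` meets the curve, so `ρ` takes every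
  -- value `t` on its zeros, and finitely many zeros would make `k` finite.
  let ρ : (Fin 3 → k) → k := fun a =>
    (Q i * a (i + 2) - Q (i + 2) * a i) / (Q i * a (i + 1) - Q (i + 1) * a i)
  refine Set.infinite_univ (α := k) (((Set.finite_iUnion H).image ρ).subset fun t _ => ?_)
  obtain ⟨α, β, hβ, hz⟩ := exists_eval_eq_zero_on_line he hp
    (Pi.single (i + 1) 1 + Pi.single (i + 2) t) hQ
  set b : Fin 3 → k := Pi.single (i + 1) 1 + Pi.single (i + 2) t with hb
  have hb0 : b i = 0 := by simp [hb, h1, h2]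
  have hb1 : b (i + 1) = 1 := by simp [hb, h3]
  have hb2 : b (i + 2) = t := by simp [hb, h3.symm]
  set a : Fin 3 → k := fun j => α * Q j + β * b j with ha
  obtain ⟨j, hj⟩ : ∃ j, a j ≠ 0 := by
    by_contra! h
    have e0 := h i
    have e1 := h (i + 1)
    simp only [ha, hb0, hb1, mul_zero, add_zero, mul_one] at e0 e1
    rcases mul_eq_zero.mp e0 with h | h
    · simp [h] at e1; exact hβ e1
    · exact hi h
  refine ⟨(a j)⁻¹ • a, Set.mem_iUnion.mpr ⟨j, ?_, ?_⟩, ?_⟩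
  · simp [hj]
  · refine (eval₂_mul_of_isHomogeneous hp (RingHom.id k) (a j)⁻¹ a).trans ?_
    exact mul_eq_zero_of_right _ hz
  · simp only [ρ, Pi.smul_apply, smul_eq_mul, ha, hb0, hb1, hb2]
    have : (Q i * ((a j)⁻¹ * (α * Q (i + 1) + β * 1)) - Q (i + 1) * ((a j)⁻¹ * (α * Q i + β * 0)))
        = (a j)⁻¹ * (Q i * β) := by ring
    rw [div_eq_iff]
    · ring
    · rw [this]
      exact mul_ne_zero (inv_ne_zero hj) (mul_ne_zero hi hβ)

end Forms

/-! ### Evaluation of degree zero fractions -/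

section Away

open HomogeneousLocalization

/-- The ring homomorphism from the degree zero part of `A[f⁻¹]` induced by a ring homomorphism
sending `f` to one. -/
noncomputable def awayEval {A σ T : Type*} [CommRing A] [SetLike σ A] [AddSubgroupClass σ A]
    (𝒜 : ℕ → σ) [GradedRing 𝒜] [CommRing T] {f : A} (φ : A →+* T) (h : φ f = 1) :
    Away 𝒜 f →+* T :=
  (Localization.awayLift φ f (h ▸ isUnit_one)).comp
    (algebraMap (Away 𝒜 f) (Localization (Submonoid.powers f)))

@[simp]
lemma awayEval_mk {A σ T : Type*} [CommRing A] [SetLike σ A] [AddSubgroupClass σ A]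
    (𝒜 : ℕ → σ) [GradedRing 𝒜] [CommRing T] {f : A} (φ : A →+* T) (h : φ f = 1) {d : ℕ}
    (hf : f ∈ 𝒜 d) (n : ℕ) (a : A) (ha : a ∈ 𝒜 (n • d)) :
    awayEval 𝒜 φ h (Away.mk 𝒜 hf n a ha) = φ a := by
  rw [awayEval, RingHom.comp_apply, HomogeneousLocalization.algebraMap_apply, Away.val_mk,
    Localization.awayLift_mk (v := 1) (hv := by simp [h])]
  simp

end Away

/-! ### Affine charts of the plane and the local ideals of the differential -/

section Charts

open MvPolynomial HomogeneousLocalization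

variable {k : Type*} [Field k]

/-- The regular function `a / Xᵢⁿ` on the chart `{Xᵢ ≠ 0}`. -/
noncomputable def frac (i : Fin 3) (n : ℕ) (a : CoordRing k) (ha : a ∈ Form k n) :
    ChartRing k i :=
  Away.mk (Form k) (X_mem k i) n a (by simpa using ha)

/-- The affine coordinates `Xₗ / Xᵢ`. -/
noncomputable def coord (i l : Fin 3) : ChartRing k i := frac i 1 (X l) (X_mem k l)

variable (k) in
/-- The inclusion of the constants into the functions on a chart. -/
noncomputable def scalar (i : Fin 3) : k →+* ChartRing k i :=
  (algebraMap (Form k 0) (ChartRing k i)).comp (algebraMap k (Form k 0))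

lemma val_frac (i : Fin 3) (n : ℕ) (a : CoordRing k) (ha : a ∈ Form k n) :
    (frac i n a ha).val = Localization.mk a (⟨X i ^ n, n, rfl⟩ : Submonoid.powers (X i : CoordRing k)) :=
  Away.val_mk _ _ _ _ _

lemma exists_eq_frac {i : Fin 3} (s : ChartRing k i) : ∃ n a ha, s = frac i n a ha := by
  obtain ⟨n, a, ha, rfl⟩ := Away.mk_surjective (Form k) (X_mem k i) s
  exact ⟨n, a, by simpa using ha, rfl⟩

/-- Homogeneity: `a(X) / Xᵢⁿ = a(X / Xᵢ)`. This reduces calculations on a chart to polynomial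
identities. -/
lemma frac_eq_eval₂ (i : Fin 3) (n : ℕ) (a : CoordRing k) (ha : a ∈ Form k n) :
    frac i n a ha = eval₂ (scalar k i) (coord i) a := by
  refine val_injective _ ?_
  have h1 : (eval₂ (scalar k i) (coord i) a).val =
      eval₂ ((algebraMap (ChartRing k i) (Localization (Submonoid.powers (X i : CoordRing k)))).comp (scalar k i))
        (fun l => (coord i l).val) a := by
    rw [← HomogeneousLocalization.algebraMap_apply, hom_eval₂]
    rfl
  have h2 : ∀ l, (coord i l : ChartRing k i).val = Localization.mk 1 (⟨X i ^ 1, 1, rfl⟩ : Submonoid.powers (X i : CoordRing k)) *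
      algebraMap (CoordRing k) (Localization (Submonoid.powers (X i : CoordRing k))) (X l) := by
    intro l
    rw [coord, val_frac, ← Localization.mk_one_eq_algebraMap, Localization.mk_mul]
    simp
  have h3 : eval₂ ((algebraMap (ChartRing k i) (Localization (Submonoid.powers (X i : CoordRing k)))).comp
      (scalar k i)) (fun l => algebraMap (CoordRing k) _ (X l)) a =
      algebraMap (CoordRing k) (Localization (Submonoid.powers (X i : CoordRing k))) a := by
    have h4 : (algebraMap (ChartRing k i) (Localization (Submonoid.powers (X i : CoordRing k)))).comp
      (scalar k i) = (algebraMap (CoordRing k) (Localization (Submonoid.powers (X i : CoordRing k)))).comp C := by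
      ext c
      exact (Localization.mk_one_eq_algebraMap _)
    rw [h4]
    change eval₂ _ ((algebraMap (CoordRing k) _) ∘ X) a = _
    rw [← eval₂_comp_left, eval₂_eta]
  rw [h1]
  simp only [h2]
  rw [eval₂_mul_of_isHomogeneous ((mem_homogeneousSubmodule _ _).mp ha), h3, val_frac, ← Localization.mk_one_eq_algebraMap,
    Localization.mk_pow, Localization.mk_mul]
  simp

lemma coord_self (i : Fin 3) : (coord i i : ChartRing k i) = 1 := by
  refine val_injective _ ?_
  rw [coord, val_frac, val_one]
  convert Localization.mk_self _
  simp

/-- The chain rule on a chart. -/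
lemma derivation_eval₂ {i : Fin 3} (θ : Derivation (Form k 0) (ChartRing k i) (ChartRing k i))
    (a : CoordRing k) :
    θ (eval₂ (scalar k i) (coord i) a) =
      ∑ j, eval₂ (scalar k i) (coord i) (pderiv j a) * θ (coord i j) := by
  induction a using MvPolynomial.induction_on with
  | C c =>
    simp only [eval₂_C, pderiv_C, eval₂_zero, zero_mul, Finset.sum_const_zero]
    exact θ.map_algebraMap _
  | add p q hp hq => simp [eval₂_add, hp, hq, add_mul, Finset.sum_add_distrib]
  | mul_X p l hp =>
    rw [eval₂_mul, eval₂_X, θ.leibniz, hp]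
    simp only [pderiv_mul, eval₂_add, eval₂_mul, eval₂_X, add_mul, Finset.sum_add_distrib,
      smul_eq_mul, Finset.mul_sum]
    rw [add_comm]
    congr 1
    · refine Finset.sum_congr rfl fun j _ => by ring
    · rw [Finset.sum_eq_single l]
      · simp
      · intro j _ hj
        simp [pderiv_X_of_ne hj.symm]
      · simp

/-- The dehomogenization of polynomials, as a homomorphism to the polynomial ring. -/
noncomputable def toPoly (i : Fin 3) : ChartRing k i →+* CoordRing k :=
  awayEval (Form k) (aeval (R := k) (Function.update X i 1)).toRingHom (by simp)

lemma toPoly_frac (i : Fin 3) (n : ℕ) (a : CoordRing k) (ha : a ∈ Form k n) :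
    toPoly i (frac i n a ha) = aeval (Function.update X i 1) a :=
  awayEval_mk _ _ _ _ _ _ _

/-- The chart ring is a retract of the polynomial ring in three variables. Noetherianity, the bound
on the dimension and the determination of the units all come from this. -/
lemma eval₂_toPoly {i : Fin 3} (s : ChartRing k i) :
    eval₂ (scalar k i) (coord i) (toPoly i s) = s := by
  obtain ⟨n, a, ha, rfl⟩ := exists_eq_frac s
  rw [toPoly_frac, frac_eq_eval₂, ← coe_eval₂Hom, ← RingHom.coe_coe (aeval _), ← RingHom.comp_apply]
  congr 1
  refine MvPolynomial.ringHom_ext (by simp) fun l => ?_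
  by_cases hl : l = i
  · subst hl; simp [coord_self]
  · simp [hl]

lemma toPoly_scalar (i : Fin 3) (c : Form k 0) :
    ∃ c' : k, toPoly i (algebraMap (Form k 0) (ChartRing k i) c) = C c' := by
  obtain ⟨c, hc⟩ := c
  have h1 : (c : CoordRing k) = C (coeff 0 c) := by
    rw [← homogeneousComponent_zero]
    exact (homogeneousComponent_eq_self ((mem_homogeneousSubmodule _ _).mp hc)).symm
  refine ⟨coeff 0 c, ?_⟩
  have : algebraMap (Form k 0) (ChartRing k i) ⟨c, hc⟩ = frac i 0 c hc := by
    refine val_injective _ ?_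
    rw [val_frac]
    rw [← HomogeneousLocalization.algebraMap_apply]
    exact congrArg (Localization.mk c) (Subtype.ext (by simp))
  rw [this, toPoly_frac, h1]
  simp

/-- The partial derivative with respect to the affine coordinate `Xₗ / Xᵢ`. -/
noncomputable def chartDeriv (i l : Fin 3) :
    Derivation (Form k 0) (ChartRing k i) (ChartRing k i) where
  toFun s := eval₂ (scalar k i) (coord i) (pderiv l (toPoly i s))
  map_add' s t := by simp [eval₂_add]
  map_smul' c s := by
    obtain ⟨c', hc'⟩ := toPoly_scalar i c
    rw [Algebra.smul_def, map_mul, hc', RingHom.id_apply, pderiv_C_mul, eval₂_mul, ← hc',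
      eval₂_toPoly, Algebra.smul_def]
  map_one_eq_zero' := by
    change eval₂ (scalar k i) (coord i) (pderiv l (toPoly i 1)) = 0
    simp
  leibniz' s t := by
    change eval₂ (scalar k i) (coord i) (pderiv l (toPoly i (s * t))) =
      s • eval₂ (scalar k i) (coord i) (pderiv l (toPoly i t)) +
      t • eval₂ (scalar k i) (coord i) (pderiv l (toPoly i s))
    rw [map_mul, pderiv_mul, eval₂_add, eval₂_mul, eval₂_mul, eval₂_toPoly, eval₂_toPoly]
    simp only [smul_eq_mul]
    ring

lemma chartDeriv_coord {i l : Fin 3} (hl : l ≠ i) (j : Fin 3) :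
    chartDeriv i l (coord i j : ChartRing k i) = if j = l then 1 else 0 := by
  change eval₂ (scalar k i) (coord i) (pderiv l (toPoly i (coord i j))) = _
  rw [coord, toPoly_frac, aeval_X]
  by_cases hj : j = i
  · subst hj
    simp [hl.symm]
  · rw [Function.update_of_ne hj]
    split_ifs with h
    · subst h; simp
    · rw [pderiv_X_of_ne h, eval₂_zero]

lemma chartDeriv_eval₂ {i l : Fin 3} (hl : l ≠ i) (a : CoordRing k) :
    chartDeriv i l (eval₂ (scalar k i) (coord i) a) =
      eval₂ (scalar k i) (coord i) (pderiv l a) := by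
  rw [derivation_eval₂]
  simp [chartDeriv_coord hl]

lemma pderiv_mem (G : Form k 6) (l : Fin 3) : pderiv l (G : CoordRing k) ∈ Form k 5 :=
  IsHomogeneous.pderiv (n := 6) G.2

/-- Euler's formula gives `6 G`, which is zero in characteristic two: the gradient is orthogonal to
the coordinate vector. -/
lemma euler [CharP k 2] (G : Form k 6) :
    (X 0 : CoordRing k) * pderiv 0 (G : CoordRing k) + (X 1 : CoordRing k) * pderiv 1 (G : CoordRing k) +
      (X 2 : CoordRing k) * pderiv 2 (G : CoordRing k) = 0 := by
  have h := IsHomogeneous.sum_X_mul_pderiv (n := 6) (φ := (G : CoordRing k)) G.2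
  rw [Fin.sum_univ_three] at h
  rw [h, nsmul_eq_mul, show ((6 : ℕ) : CoordRing k) = 0 from
    (CharP.cast_eq_zero_iff (CoordRing k) 2 6).mpr (by norm_num), zero_mul]

lemma mem_zeroIdeal {A M : Type*} [CommRing A] [AddCommGroup M] [Module A M] {ω : M} {a : A} :
    a ∈ zeroIdeal (A := A) ω ↔ ∃ f : Module.Dual A M, f ω = a := by
  rfl

/-- The ideal of `Z(dG)` on a chart is generated by the dehomogenized partial derivatives. -/
lemma zeroIdeal_eq_span [CharP k 2] (G : Form k 6) (i : Fin 3) :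
    zeroIdeal (A := ChartRing k i)
      (KaehlerDifferential.D (Form k 0) (ChartRing k i) (dehomogenize G i)) =
    Ideal.span (Set.range fun l => frac i 5 (pderiv l (G : CoordRing k)) (pderiv_mem G l)) := by
  have hd : dehomogenize G i = eval₂ (scalar k i) (coord i) (G : CoordRing k) :=
    frac_eq_eval₂ (k := k) i 6 (G : CoordRing k) G.2
  refine le_antisymm ?_ ?_
  · intro s hs
    obtain ⟨f, rfl⟩ := mem_zeroIdeal.mp hs
    have h1 : f (KaehlerDifferential.D (Form k 0) (ChartRing k i) (dehomogenize G i)) =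
        f.compDer (KaehlerDifferential.D (Form k 0) (ChartRing k i)) (dehomogenize G i) := rfl
    rw [h1, hd, derivation_eval₂]
    refine Ideal.sum_mem _ fun j _ => Ideal.mul_mem_right _ _ (Ideal.subset_span ⟨j, ?_⟩)
    exact frac_eq_eval₂ _ _ _ _
  · have hl : ∀ l, l ≠ i → frac i 5 (pderiv l (G : CoordRing k)) (pderiv_mem G l) ∈
        zeroIdeal (A := ChartRing k i)
          (KaehlerDifferential.D (Form k 0) (ChartRing k i) (dehomogenize G i)) := by
      intro l hl
      refine mem_zeroIdeal.mpr ⟨(chartDeriv i l).liftKaehlerDifferential, ?_⟩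
      rw [Derivation.liftKaehlerDifferential_comp_D, hd, chartDeriv_eval₂ hl, frac_eq_eval₂]
    rw [Ideal.span_le]
    rintro _ ⟨l, rfl⟩
    by_cases h : l = i
    -- There is no coordinate direction `l = i` on the chart; since `Xᵢ / Xᵢ = 1`, Euler's relation
    -- expresses this partial derivative through the others.
    · subst h
      have he : ∑ j, coord l j * frac l 5 (pderiv j (G : CoordRing k)) (pderiv_mem G j) = 0 := by
        have := congrArg (eval₂ (scalar k l) (coord l)) (euler G)
        simp only [eval₂_add, eval₂_mul, eval₂_X, eval₂_zero] at this
        simpa only [frac_eq_eval₂, Fin.sum_univ_three] using this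
      rw [← Finset.add_sum_erase _ _ (Finset.mem_univ l), coord_self, one_mul] at he
      change frac l 5 _ _ ∈ _
      rw [eq_neg_of_add_eq_zero_left he]
      refine neg_mem (Ideal.sum_mem _ fun j hj => Ideal.mul_mem_left _ _ (hl j ?_))
      exact Finset.ne_of_mem_erase hj
    · exact hl l h

end Charts

/-! ### Ideal sheaves on affine schemes and open immersions -/

section IdealSheaves

open Scheme.IdealSheafData

/-- Kernels commute with pullback along open immersions. -/
lemma comap_ker_of_isOpenImmersion {X Y V : Scheme} (f : X ⟶ Y) [QuasiCompact f] (c : V ⟶ Y)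
    [IsOpenImmersion c] : f.ker.comap c = (pullback.fst c f).ker := by
  refine Scheme.IdealSheafData.ext (funext fun U => ?_)
  rw [ideal_comap_of_isOpenImmersion]
  exact (Scheme.ker_ideal_of_isPullback_of_isOpenImmersion f _ _ c
    (IsPullback.of_hasPullback c f) U).symm

lemma comap_iInf_of_isOpenImmersion {Y V : Scheme} {ι : Type*} [Finite ι]
    (I : ι → Y.IdealSheafData) (c : V ⟶ Y) [IsOpenImmersion c] :
    (⨅ j, I j).comap c = ⨅ j, (I j).comap c := by
  refine Scheme.IdealSheafData.ext (funext fun U => ?_)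
  simp only [ideal_comap_of_isOpenImmersion, ideal_iInf, iInf_apply, Ideal.comap_iInf]

/-- The ideal sheaf on an affine scheme defined by an ideal. -/
noncomputable def idealSheaf {A : Type*} [CommRing A] (I : Ideal A) :
    (Spec (.of A)).IdealSheafData :=
  ofIdealTop (I.comap (Scheme.ΓSpecIso (.of A)).hom.hom)

lemma ideal_ofIdealTop_top {Y : Scheme} [IsAffine Y] (I : Ideal Γ(Y, ⊤)) :
    (ofIdealTop I).ideal ⟨⊤, isAffineOpen_top _⟩ = I := by
  rw [ofIdealTop_ideal]
  have : Y.presheaf.map (homOfLE (le_top (a := ⊤))).op = 𝟙 _ := Y.presheaf.map_id _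
  erw [this]
  exact Ideal.map_id _

lemma ideal_idealSheaf_top {A : Type*} [CommRing A] (I : Ideal A) :
    (idealSheaf I).ideal ⟨⊤, isAffineOpen_top _⟩ =
      I.comap (Scheme.ΓSpecIso (.of A)).hom.hom :=
  ideal_ofIdealTop_top _

lemma idealSheaf_le_iff {A : Type*} [CommRing A] {I : Ideal A} {J : (Spec (.of A)).IdealSheafData} :
    idealSheaf I ≤ J ↔ ∀ s ∈ I, (Scheme.ΓSpecIso (.of A)).inv.hom s ∈
      J.ideal ⟨⊤, isAffineOpen_top _⟩ := by
  have h2 : ∀ s, s ∈ I ↔ (Scheme.ΓSpecIso (.of A)).inv.hom s ∈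
      (idealSheaf I).ideal ⟨⊤, isAffineOpen_top _⟩ := by
    intro s
    rw [ideal_idealSheaf_top, Ideal.mem_comap]
    simp
  refine ⟨fun h s hs => h _ ((h2 s).mp hs), fun h => le_of_isAffine fun t ht => ?_⟩
  have h3 := h ((Scheme.ΓSpecIso (.of A)).hom.hom t) (by rwa [ideal_idealSheaf_top] at ht)
  simpa using h3

lemma idealSheaf_le_idealSheaf {A : Type*} [CommRing A] {I J : Ideal A}
    (h : idealSheaf I ≤ idealSheaf J) : I ≤ J := by
  intro s hs
  have h1 := idealSheaf_le_iff.mp h s hs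
  rw [ideal_idealSheaf_top, Ideal.mem_comap] at h1
  simpa using h1

lemma mem_ker_ideal_top {X Y : Scheme} [IsAffine Y] (f : X ⟶ Y) {s : Γ(Y, ⊤)}
    (h : f.appTop.hom s = 0) : s ∈ f.ker.ideal ⟨⊤, isAffineOpen_top _⟩ := by
  rw [Scheme.ker_of_isAffine, ideal_ofIdealTop_top]
  exact h

lemma subschemeι_appTop_eq_zero {A : Type*} [CommRing A] {I : Ideal A} {s : A} (hs : s ∈ I) :
    (idealSheaf I).subschemeι.appTop.hom ((Scheme.ΓSpecIso (.of A)).inv.hom s) = 0 := by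
  have h := (idealSheaf I).ker_subschemeι_app ⟨⊤, isAffineOpen_top _⟩
  rw [← RingHom.mem_ker]
  erw [h]
  rw [ideal_idealSheaf_top, Ideal.mem_comap]
  simpa using hs

universe u in
lemma appTop_comp_specMap {A B : Type u} [CommRing A] [CommRing B] {P : Scheme.{u}}
    (t : P ⟶ Spec (.of B)) (φ : A →+* B) (s : A) :
    (t ≫ Spec.map (CommRingCat.ofHom φ)).appTop.hom ((Scheme.ΓSpecIso (.of A)).inv.hom s) =
      t.appTop.hom ((Scheme.ΓSpecIso (.of B)).inv.hom (φ s)) := by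
  have h := congrArg (fun f => f.hom s) (Scheme.ΓSpecIso_inv_naturality (CommRingCat.ofHom φ))
  simp only [CommRingCat.hom_comp, RingHom.comp_apply, CommRingCat.hom_ofHom] at h
  rw [Scheme.Hom.comp_appTop, CommRingCat.hom_comp, RingHom.comp_apply, h]

end IdealSheaves

/-! ### Gluing the local zero schemes -/

section Overlaps

open MvPolynomial HomogeneousLocalization Scheme.IdealSheafData

variable {k : Type*} [Field k]

instance (i : Fin 3) : IsOpenImmersion (chartMap k i) := by
  unfold chartMap
  infer_instance

/-- The transition function of `𝒪(n)`: on the overlap, `a / Xᵢⁿ` and `a / Xⱼⁿ` differ by the factor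
`(Xⱼ / Xᵢ)ⁿ`. -/
lemma awayMap_frac (i j : Fin 3) {x : CoordRing k} (hx : x = X i * X j) (n : ℕ) (a : CoordRing k)
    (ha : a ∈ Form k n) :
    awayMap (Form k) (X_mem k j) hx (frac i n a ha) =
      awayMap (Form k) (X_mem k j) hx (coord i j) ^ n *
        awayMap (Form k) (X_mem k i) (hx.trans (mul_comm _ _)) (frac j n a ha) := by
  unfold coord frac
  rw [awayMap_mk, awayMap_mk, awayMap_mk]
  refine val_injective _ ?_
  rw [val_mul, val_pow, Away.val_mk, Away.val_mk, Away.val_mk, Localization.mk_pow,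
    Localization.mk_mul, Localization.mk_eq_mk_iff, Localization.r_iff_exists]
  refine ⟨1, ?_⟩
  simp [hx]
  ring

lemma exists_lift_overlap (i j : Fin 3) {P : Scheme} (a : P ⟶ Spec (.of (ChartRing k i)))
    (b : P ⟶ Spec (.of (ChartRing k j))) (hab : a ≫ chartMap k i = b ≫ chartMap k j) :
    ∃ t : P ⟶ Spec (.of (Away (Form k) (X i * X j : CoordRing k))),
      t ≫ Spec.map (CommRingCat.ofHom (awayMap (Form k) (X_mem k j) rfl)) = a ∧
      t ≫ Spec.map (CommRingCat.ofHom (awayMap (Form k) (X_mem k i) (mul_comm _ _))) = b := by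
  unfold chartMap at hab
  refine ⟨pullback.lift a b hab ≫ (Proj.pullbackAwayιIso (Form k) (X_mem k i) Nat.one_pos
    (X_mem k j) Nat.one_pos rfl).hom, ?_, ?_⟩
  · rw [Category.assoc, Proj.pullbackAwayιIso_hom_SpecMap_awayMap_left, pullback.lift_fst]
  · rw [Category.assoc, Proj.pullbackAwayιIso_hom_SpecMap_awayMap_right, pullback.lift_snd]

/-- The local zero schemes agree on overlaps. The pushforward from chart `j` is the kernel of its
zero scheme mapping to the plane, and its restriction to chart `i` is the kernel of the pullback
`P`. On `P` each generator `∂ₗG / Xᵢ⁵` is a multiple of `∂ₗG / Xⱼ⁵`, which vanishes there. -/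
lemma idealSheaf_le_comap_map [CharP k 2] (G : Form k 6) (i j : Fin 3) :
    idealSheaf (zeroIdeal (A := ChartRing k i)
      (KaehlerDifferential.D (Form k 0) (ChartRing k i) (dehomogenize G i))) ≤
    ((idealSheaf (zeroIdeal (A := ChartRing k j)
      (KaehlerDifferential.D (Form k 0) (ChartRing k j) (dehomogenize G j)))).map
        (chartMap k j)).comap (chartMap k i) := by
  rw [zeroIdeal_eq_span, zeroIdeal_eq_span]
  set I := fun j => Ideal.span (Set.range fun l => frac j 5 (pderiv l (G : CoordRing k)) (pderiv_mem G l))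
  set f := (idealSheaf (I j)).subschemeι ≫ chartMap k j with hf
  change _ ≤ f.ker.comap (chartMap k i)
  rw [comap_ker_of_isOpenImmersion, idealSheaf_le_iff]
  set P := pullback (chartMap k i) f
  set a : P ⟶ Spec (.of (ChartRing k i)) := pullback.fst (chartMap k i) f
  set b : P ⟶ Spec (.of (ChartRing k j)) :=
    pullback.snd (chartMap k i) f ≫ (idealSheaf (I j)).subschemeι with hb
  have hab : a ≫ chartMap k i = b ≫ chartMap k j := by
    rw [hb, Category.assoc]
    exact pullback.condition
  obtain ⟨t, hta, htb⟩ := exists_lift_overlap i j a b hab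
  have hψa : ∀ s, a.appTop.hom ((Scheme.ΓSpecIso (.of (ChartRing k i))).inv.hom s) =
      t.appTop.hom ((Scheme.ΓSpecIso _).inv.hom (awayMap (Form k) (X_mem k j) rfl s)) := by
    intro s
    rw [← hta, appTop_comp_specMap]
  have hψb : ∀ s, b.appTop.hom ((Scheme.ΓSpecIso (.of (ChartRing k j))).inv.hom s) =
      t.appTop.hom ((Scheme.ΓSpecIso _).inv.hom
        (awayMap (Form k) (X_mem k i) (mul_comm _ _) s)) := by
    intro s
    rw [← htb, appTop_comp_specMap]
  have hkill : ∀ s ∈ I j, b.appTop.hom ((Scheme.ΓSpecIso (.of (ChartRing k j))).inv.hom s) = 0 := by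
    intro s hs
    rw [hb, Scheme.Hom.comp_appTop, CommRingCat.hom_comp, RingHom.comp_apply,
      subschemeι_appTop_eq_zero hs, map_zero]
  have hker : I i ≤ RingHom.ker ((Scheme.ΓSpecIso (.of (ChartRing k i))).inv ≫ a.appTop).hom := by
    rw [Ideal.span_le]
    rintro _ ⟨l, rfl⟩
    rw [SetLike.mem_coe, RingHom.mem_ker]
    change a.appTop.hom ((Scheme.ΓSpecIso (.of (ChartRing k i))).inv.hom _) = 0
    rw [hψa, awayMap_frac, map_mul, map_mul, ← hψb, hkill _ (Ideal.subset_span ⟨l, rfl⟩), mul_zero]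
  exact fun s hs => mem_ker_ideal_top a (hker hs)

/-- The global ideal sheaf restricts on chart `i` to the local ideal: one inclusion is the gluing,
the other is the `i`-th term of the infimum together with the adjunction of `map` and `comap`. -/
lemma zeroIdeal_le_of_zeroSchemeD_le [CharP k 2] {G G' : Form k 6}
    (h : zeroSchemeD G ≤ zeroSchemeD G') (i : Fin 3) :
    zeroIdeal (A := ChartRing k i)
      (KaehlerDifferential.D (Form k 0) (ChartRing k i) (dehomogenize G i)) ≤
    zeroIdeal (A := ChartRing k i)
      (KaehlerDifferential.D (Form k 0) (ChartRing k i) (dehomogenize G' i)) := by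
  refine idealSheaf_le_idealSheaf ?_
  have h1 : idealSheaf (zeroIdeal (A := ChartRing k i)
      (KaehlerDifferential.D (Form k 0) (ChartRing k i) (dehomogenize G i))) ≤
      (zeroSchemeD G).comap (chartMap k i) := by
    rw [zeroSchemeD, comap_iInf_of_isOpenImmersion]
    exact le_iInf fun j => idealSheaf_le_comap_map G i j
  refine h1.trans ((comap_mono _ h).trans ?_)
  rw [← le_map_iff_comap_le]
  exact iInf_le _ i

end Overlaps

/-! ### Affine charts of the double cover -/

section CoverCharts

open MvPolynomial HomogeneousLocalization

variable {k : Type*} [Field k] (G : Form k 6)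

/-- The coordinate ring of the chart `{Xᵢ ≠ 0}` of the double cover. -/
abbrev CoverChart (i : Fin 3) : Type _ := Away (coverGrading G) (coverCoord G i)

/-- The pullback of functions from a chart of the plane to the double cover. -/
noncomputable def chartIncl (i : Fin 3) : ChartRing k i →+* CoverChart G i :=
  Away.map (coordIncl G) (X i)

/-- The function `W / Xᵢ³`. -/
noncomputable def rootFun (i : Fin 3) : CoverChart G i :=
  Away.mk (coverGrading G) (coverCoord_mem G i) 3 (AdjoinRoot.root _) (root_mem G)

lemma val_chartIncl_frac (i : Fin 3) (n : ℕ) (a : CoordRing k) (ha : a ∈ Form k n) :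
    (chartIncl G i (frac i n a ha)).val =
      Localization.mk (AdjoinRoot.of _ a : CoverRing G)
        (⟨coverCoord G i ^ n, n, rfl⟩ : Submonoid.powers (coverCoord G i)) := by
  unfold chartIncl frac
  rw [Away.map_mk]
  exact Away.val_mk _ _ _ _ _

lemma val_rootFun (i : Fin 3) :
    (rootFun G i).val = Localization.mk (AdjoinRoot.root _ : CoverRing G)
      (⟨coverCoord G i ^ 3, 3, rfl⟩ : Submonoid.powers (coverCoord G i)) :=
  Away.val_mk _ _ _ _ _

lemma rootFun_sq (i : Fin 3) : rootFun G i ^ 2 = chartIncl G i (dehomogenize G i) := by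
  refine val_injective _ ?_
  have h : dehomogenize G i = frac i 6 (G : CoordRing k) G.2 := rfl
  rw [val_pow, val_rootFun, h, val_chartIncl_frac, Localization.mk_pow, root_sq]
  congr 1
  ext
  simp [← pow_mul]

lemma mk_of_mul_root_pow (i : Fin 3) {m j n : ℕ} (hn : m + 3 * j = n) {a : CoordRing k}
    (ha : a ∈ Form k m)
    (hx : (AdjoinRoot.of _ a * AdjoinRoot.root _ ^ j : CoverRing G) ∈ coverGrading G (n • 1)) :
    Away.mk (coverGrading G) (coverCoord_mem G i) n (AdjoinRoot.of _ a * AdjoinRoot.root _ ^ j) hx =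
      chartIncl G i (frac i m a ha) * rootFun G i ^ j := by
  subst hn
  refine val_injective _ ?_
  rw [val_mul, val_pow, val_rootFun, val_chartIncl_frac, Away.val_mk, Localization.mk_pow,
    Localization.mk_mul]
  congr 1
  ext
  simp [pow_add, pow_mul]

lemma scalar_eq_frac (i : Fin 3) (c : k) :
    scalar k i c = frac i 0 (C c) ((mem_homogeneousSubmodule _ _).mpr (isHomogeneous_C _ _)) := by
  rw [frac_eq_eval₂, eval₂_C]

/-- The functions on a chart of the double cover are generated by `1` and `W / Xᵢ³` over the functions
on the chart of the plane. -/
lemma exists_eq_add_mul_rootFun (i : Fin 3) (s : CoverChart G i) :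
    ∃ α β, s = chartIncl G i α + chartIncl G i β * rootFun G i := by
  obtain ⟨n, x, hx, rfl⟩ := Away.mk_surjective (coverGrading G) (coverCoord_mem G i) s
  have hx' : x ∈ coverGrading G n := by simpa using hx
  induction hx' using Submodule.span_induction with
  | zero =>
    refine ⟨0, 0, val_injective _ ?_⟩
    simp [Away.val_mk, Localization.mk_zero]
  | add x y hx' hy' h h' =>
    obtain ⟨α, β, h⟩ := h (by rw [smul_eq_mul, mul_one]; exact hx')
    obtain ⟨α', β', h'⟩ := h' (by rw [smul_eq_mul, mul_one]; exact hy')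
    refine ⟨α + α', β + β', ?_⟩
    rw [map_add, map_add, add_mul, add_add_add_comm, ← h, ← h']
    refine val_injective _ ?_
    simp [Away.val_mk, Localization.add_mk_self]
  | smul c x hx' h =>
    obtain ⟨α, β, h⟩ := h (by rw [smul_eq_mul, mul_one]; exact hx')
    refine ⟨scalar k i c * α, scalar k i c * β, ?_⟩
    rw [map_mul, map_mul, mul_assoc, ← mul_add, ← h]
    rw [scalar_eq_frac]
    refine val_injective _ ?_
    rw [val_mul, val_chartIncl_frac, Away.val_mk, Away.val_mk, Localization.mk_mul]
    rw [Algebra.smul_def]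
    congr 1
    ext
    simp
  | mem x hx' =>
    obtain ⟨m, j, hn, a, ha, rfl⟩ := hx'
    rw [mk_of_mul_root_pow G i hn ha]
    rcases Nat.even_or_odd' j with ⟨l, rfl | rfl⟩
    · refine ⟨frac i m a ha * dehomogenize G i ^ l, 0, ?_⟩
      rw [pow_mul, rootFun_sq]
      simp
    · refine ⟨0, frac i m a ha * dehomogenize G i ^ l, ?_⟩
      rw [pow_succ (rootFun G i), pow_mul, rootFun_sq]
      simp [mul_assoc]

instance (i : Fin 3) : IsNoetherianRing (ChartRing k i) :=
  isNoetherianRing_of_surjective (CoordRing k) _ (eval₂Hom (scalar k i) (coord i))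
    fun s => ⟨toPoly i s, eval₂_toPoly s⟩

lemma ringKrullDim_chartRing_le (i : Fin 3) : ringKrullDim (ChartRing k i) + 1 ≤ 3 := by
  have hne : (X i - 1 : CoordRing k) ≠ 0 := by
    intro h
    have := congrArg (eval (0 : Fin 3 → k)) h
    simp at this
  have h := ringKrullDim_succ_le_of_surjective (eval₂Hom (scalar k i) (coord i))
    (fun s => ⟨toPoly i s, eval₂_toPoly s⟩) (mem_nonZeroDivisors_of_ne_zero hne)
    (by simp [coord_self])
  refine h.trans ?_
  simp [MvPolynomial.ringKrullDim_of_isNoetherianRing]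

/-- The chart is a quotient of a polynomial ring in one variable over the chart of the plane, with
the monic `T² - G / Xᵢ⁶` in the kernel, so its dimension is at most two. -/
lemma ringKrullDim_coverChart_le (i : Fin 3) : ringKrullDim (CoverChart G i) + 1 ≤ 3 := by
  let ψ : Polynomial (ChartRing k i) →+* CoverChart G i :=
    Polynomial.eval₂RingHom (chartIncl G i) (rootFun G i)
  have hψ : Function.Surjective ψ := by
    intro s
    obtain ⟨α, β, rfl⟩ := exists_eq_add_mul_rootFun G i s
    exact ⟨Polynomial.C α + Polynomial.C β * Polynomial.X, by simp [ψ]⟩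
  have hmonic : (Polynomial.X ^ 2 - Polynomial.C (dehomogenize G i)).Monic :=
    Polynomial.monic_X_pow_sub_C _ two_ne_zero
  have h := ringKrullDim_succ_le_of_surjective ψ hψ hmonic.mem_nonZeroDivisors
    (by simp [ψ, rootFun_sq])
  rw [Polynomial.ringKrullDim_of_isNoetherianRing] at h
  exact h.trans (ringKrullDim_chartRing_le i)

end CoverCharts

/-! ### Zeros of the differential give singular points -/

section Singularities

open MvPolynomial HomogeneousLocalization

/-- The ring of dual numbers in three directions. -/
abbrev DualRing (k : Type*) : Type _ := TrivSqZeroExt k (Fin 3 → k)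

instance (k : Type*) [Field k] : IsLocalRing (DualRing k) :=
  have : IsLocalHom (TrivSqZeroExt.fstHom k k (Fin 3 → k)).toRingHom :=
    ⟨fun _ h => TrivSqZeroExt.isUnit_iff_isUnit_fst.mpr h⟩
  RingHom.domain_isLocalRing (TrivSqZeroExt.fstHom k k (Fin 3 → k)).toRingHom

lemma mem_maximalIdeal_dualRing {k : Type*} [Field k] {x : DualRing k} :
    x ∈ IsLocalRing.maximalIdeal (DualRing k) ↔ x.fst = 0 := by
  rw [IsLocalRing.mem_maximalIdeal, mem_nonunits_iff, TrivSqZeroExt.isUnit_iff_isUnit_fst,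
    isUnit_iff_ne_zero, not_not]

/-- A local ring which maps onto the dual numbers in three directions has embedding dimension at least
three. -/
lemma le_spanFinrank_of_surjective {k O : Type*} [Field k] [CommRing O] [IsLocalRing O]
    [IsNoetherianRing O] (f : O →+* DualRing k) (hf : Function.Surjective f) :
    3 ≤ (IsLocalRing.maximalIdeal O).spanFinrank := by
  classical
  have hloc : IsLocalHom f := .of_surjective f hf
  obtain ⟨S, hS, hspan⟩ := Submodule.FG.exists_span_finset_card_eq_spanFinrank
    (IsNoetherian.noetherian (IsLocalRing.maximalIdeal O))
  rw [← hS]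
  have htop : Submodule.span k ((S.image fun s => (f s).snd : Finset (Fin 3 → k)) :
      Set (Fin 3 → k)) = ⊤ := by
    refine top_le_iff.mp fun v _ => ?_
    obtain ⟨x, hx⟩ := hf (TrivSqZeroExt.inr v)
    have hxm : x ∈ IsLocalRing.maximalIdeal O := by
      rw [IsLocalRing.mem_maximalIdeal, mem_nonunits_iff]
      intro hu
      have := TrivSqZeroExt.isUnit_iff_isUnit_fst.mp (hu.map f)
      simp [hx] at this
    have hv : (f x).snd = v := by simp [hx]
    rw [← hv]
    rw [← hspan] at hxm
    have hgen : ∀ y ∈ Submodule.span O (S : Set O), (f y).fst = 0 ∧ (f y).snd ∈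
        Submodule.span k ((S.image fun s => (f s).snd : Finset (Fin 3 → k)) :
          Set (Fin 3 → k)) := by
      intro y hy
      induction hy using Submodule.span_induction with
      | mem y hy =>
        refine ⟨?_, Submodule.subset_span (by simpa using ⟨y, hy, rfl⟩)⟩
        have h1 : y ∈ IsLocalRing.maximalIdeal O := hspan ▸ Submodule.subset_span hy
        rw [← mem_maximalIdeal_dualRing, IsLocalRing.mem_maximalIdeal, mem_nonunits_iff]
        exact fun hu => h1 (hloc.map_nonunit y hu)
      | zero => simp
      | add y z _ _ hy hz => simpa [hy.1, hz.1] using add_mem hy.2 hz.2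
      | smul c y _ hy =>
        refine ⟨by simp [hy.1], ?_⟩
        rw [smul_eq_mul, map_mul, TrivSqZeroExt.snd_mul, hy.1]
        simpa using Submodule.smul_mem _ _ hy.2
    exact (hgen x hxm).2
  have h1 := finrank_span_le_card (R := k)
    ((S.image fun s => (f s).snd : Finset (Fin 3 → k)) : Set (Fin 3 → k))
  rw [htop, finrank_top, Module.finrank_fin_fun, Finset.toFinset_coe] at h1
  exact h1.trans Finset.card_image_le

section

universe u

variable {X : Scheme.{u}} {R : CommRingCat.{u}}

lemma stalkClosedPointTo_surjective {S : CommRingCat.{u}} [IsLocalRing S] (φ : R ⟶ S)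
    (hφ : Function.Surjective φ.hom) (ι : Spec R ⟶ X) [IsOpenImmersion ι] :
    Function.Surjective (Scheme.stalkClosedPointTo (Spec.map φ ≫ ι)).hom := by
  rw [Scheme.stalkClosedPointTo_comp]
  have h1 : Function.Surjective (Scheme.stalkClosedPointTo (Spec.map φ)).hom := by
    have h2 : Function.Surjective
        ((Spec R).presheaf.germ ⊤ _ trivial ≫ Scheme.stalkClosedPointTo (Spec.map φ)).hom := by
      rw [Scheme.germ_stalkClosedPointTo_Spec]
      exact hφ.comp (ConcreteCategory.bijective_of_isIso (Scheme.ΓSpecIso R).hom).2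
    exact Function.Surjective.of_comp h2
  exact h1.comp (ConcreteCategory.bijective_of_isIso (Scheme.Hom.stalkMap ι _)).2

lemma ringKrullDim_stalk_le (ι : Spec R ⟶ X) [IsOpenImmersion ι] (z : Spec R) :
    ringKrullDim (X.presheaf.stalk (ι z)) ≤ ringKrullDim R := by
  rw [ringKrullDim_stalk_eq_coheight, coheight_eq_of_isOpenImmersion, ← idealHeight_eq_coheight]
  have : z.asIdeal.IsPrime := PrimeSpectrum.isPrime z
  exact Ideal.height_le_ringKrullDim_of_isPrime

/-- The embedding dimension of the local ring is at least three, whereas its Krull dimension is at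
most two. -/
lemma not_isRegularLocalRing_stalk {k : Type u} [Field k] (φ : R ⟶ .of (DualRing k))
    (hφ : Function.Surjective φ.hom) (ι : Spec R ⟶ X) [IsOpenImmersion ι]
    (hR : ringKrullDim R + 1 ≤ 3) :
    ¬ IsRegularLocalRing
      (X.presheaf.stalk ((Spec.map φ ≫ ι) (IsLocalRing.closedPoint (DualRing k)))) := by
  intro hreg
  have := hreg.toIsNoetherian
  have h1 : 3 ≤ (IsLocalRing.maximalIdeal (X.presheaf.stalk
      ((Spec.map φ ≫ ι) (IsLocalRing.closedPoint (DualRing k))))).spanFinrank :=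
    le_spanFinrank_of_surjective (k := k) (Scheme.stalkClosedPointTo (Spec.map φ ≫ ι)).hom
      (stalkClosedPointTo_surjective φ hφ ι)
  have h2 := hreg.spanFinrank_maximalIdeal
  have h3 : ringKrullDim (X.presheaf.stalk
      ((Spec.map φ ≫ ι) (IsLocalRing.closedPoint (DualRing k)))) ≤ ringKrullDim R :=
    ringKrullDim_stalk_le ι _
  have h4 := (add_le_add_left h3 1).trans hR
  rw [← h2] at h4
  have h5 : (IsLocalRing.maximalIdeal (X.presheaf.stalk
      ((Spec.map φ ≫ ι) (IsLocalRing.closedPoint (DualRing k))))).spanFinrank + 1 ≤ 3 := by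
    exact_mod_cast h4
  omega

end

variable {k : Type*} [Field k]

/-- The first order Taylor expansion. -/
lemma aeval_inl_add_inr (a : Fin 3 → k) (v : Fin 3 → Fin 3 → k) (F : CoordRing k) :
    aeval (fun j => (TrivSqZeroExt.inl (a j) + TrivSqZeroExt.inr (v j) : DualRing k)) F =
      TrivSqZeroExt.inl (eval a F) +
        TrivSqZeroExt.inr (∑ j, eval a (pderiv j F) • v j) := by
  induction F using MvPolynomial.induction_on with
  | C c => simp; rfl
  | add p q hp hq =>
    rw [map_add, hp, hq]
    ext <;> simp [add_mul, Finset.sum_add_distrib]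
  | mul_X p l hp =>
    rw [map_mul, hp, aeval_X]
    ext t
    · simp
    · simp only [TrivSqZeroExt.snd_mul, TrivSqZeroExt.fst_add, TrivSqZeroExt.snd_add,
        TrivSqZeroExt.fst_inl, TrivSqZeroExt.fst_inr, TrivSqZeroExt.snd_inl,
        TrivSqZeroExt.snd_inr, add_zero, zero_add, pderiv_mul, map_add, map_mul, eval_X, add_smul,
        Finset.sum_add_distrib, op_smul_eq_smul, Pi.add_apply, Pi.smul_apply,
        Finset.sum_apply, smul_eq_mul, Finset.mul_sum]
      rw [Pi.zero_apply, zero_add, add_comm]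
      refine congrArg₂ (· + ·) (Finset.sum_congr rfl fun j _ => by ring) ?_
      rw [Finset.sum_eq_single l]
      · simp
      · intro j _ hj
        simp [pderiv_X_of_ne hj.symm]
      · simp

variable (G : Form k 6) {i : Fin 3} {a : Fin 3 → k} {w : k}

/-- The homomorphism from the cover ring to the dual numbers given by the point `(a, w)` and all
tangent vectors at this point. -/
noncomputable def tangentHom [CharP k 2] (i : Fin 3) (hw : w ^ 2 = eval a (G : CoordRing k))
    (hd : ∀ j, eval a (pderiv j (G : CoordRing k)) = 0) : CoverRing G →+* DualRing k :=
  -- On the chart `Xᵢ` is normalized to `1`, so it gets no tangent component and direction `i` is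
  -- left for `W`. The equation holds to first order because `dG` vanishes at `a` and the linear
  -- term `2 w` of the square is zero.
  AdjoinRoot.lift (aeval fun j => (TrivSqZeroExt.inl (a j) +
      TrivSqZeroExt.inr (if j = i then 0 else Pi.single j 1) : DualRing k)).toRingHom
    (TrivSqZeroExt.inl w + TrivSqZeroExt.inr (Pi.single i 1)) (by
      rw [Polynomial.eval₂_sub, Polynomial.eval₂_pow, Polynomial.eval₂_X, Polynomial.eval₂_C,
        sub_eq_zero]
      refine Eq.trans ?_ (aeval_inl_add_inr a _ _).symm
      simp only [hd, zero_smul, Finset.sum_const_zero]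
      rw [← hw]
      ext t
      · simp
      · simp [sq, ← two_smul k, CharTwo.two_eq_zero])

section
variable [CharP k 2] (hi : a i = 1) (hw : w ^ 2 = eval a (G : CoordRing k))
    (hd : ∀ j, eval a (pderiv j (G : CoordRing k)) = 0)

lemma tangentHom_of (F : CoordRing k) : tangentHom G i hw hd (AdjoinRoot.of _ F) =
    aeval (fun j => (TrivSqZeroExt.inl (a j) +
      TrivSqZeroExt.inr (if j = i then 0 else Pi.single j 1) : DualRing k)) F :=
  AdjoinRoot.lift_of _

lemma tangentHom_root : tangentHom G i hw hd (AdjoinRoot.root _) =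
    TrivSqZeroExt.inl w + TrivSqZeroExt.inr (Pi.single i 1) :=
  AdjoinRoot.lift_root _

include hi in
lemma tangentHom_coverCoord : tangentHom G i hw hd (coverCoord G i) = 1 := by
  refine (tangentHom_of G hw hd (X i)).trans ?_
  simp [hi]

/-- The homomorphism from the coordinate ring of a chart to the dual numbers given by a point and
all tangent vectors at this point. -/
noncomputable def chartTangentHom : CoverChart G i →+* DualRing k :=
  awayEval (coverGrading G) (tangentHom G i hw hd) (tangentHom_coverCoord G hi hw hd)

lemma chartTangentHom_frac (n : ℕ) (F : CoordRing k) (hF : F ∈ Form k n) :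
    chartTangentHom G hi hw hd (chartIncl G i (frac i n F hF)) = aeval (fun j =>
      (TrivSqZeroExt.inl (a j) +
        TrivSqZeroExt.inr (if j = i then 0 else Pi.single j 1) : DualRing k)) F := by
  unfold chartIncl frac
  rw [Away.map_mk]
  refine (awayEval_mk _ _ _ _ _ _ _).trans ?_
  exact tangentHom_of G hw hd F

lemma chartTangentHom_rootFun : chartTangentHom G hi hw hd (rootFun G i) =
    TrivSqZeroExt.inl w + TrivSqZeroExt.inr (Pi.single i 1) :=
  (awayEval_mk _ _ _ _ _ _ _).trans (tangentHom_root G hw hd)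

lemma chartTangentHom_surjective : Function.Surjective (chartTangentHom G hi hw hd) := by
  rw [← RingHom.range_eq_top]
  set S := (chartTangentHom G hi hw hd).range
  have hinl : ∀ c : k, (TrivSqZeroExt.inl c : DualRing k) ∈ S := fun c =>
    ⟨_, (chartTangentHom_frac G hi hw hd 0 (C c)
      ((mem_homogeneousSubmodule _ _).mpr (isHomogeneous_C _ _))).trans (aeval_C _ _)⟩
  have hinr : ∀ j, (TrivSqZeroExt.inr (Pi.single j 1) : DualRing k) ∈ S := by
    intro j
    by_cases hj : j = i
    · subst hj
      have h1 : TrivSqZeroExt.inl w + TrivSqZeroExt.inr (Pi.single j 1) ∈ S :=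
        ⟨_, chartTangentHom_rootFun G hi hw hd⟩
      simpa using sub_mem h1 (hinl w)
    · have h1 : TrivSqZeroExt.inl (a j) + TrivSqZeroExt.inr (Pi.single j 1) ∈ S :=
        ⟨_, (chartTangentHom_frac G hi hw hd 1 (X j) (X_mem k j)).trans (by simp [hj])⟩
      simpa using sub_mem h1 (hinl (a j))
  refine top_le_iff.mp fun x _ => ?_
  have hx : x = TrivSqZeroExt.inl x.fst + ∑ j, TrivSqZeroExt.inl (x.snd j) *
      TrivSqZeroExt.inr (Pi.single j 1) := by
    ext t
    · simp [TrivSqZeroExt.fst_sum]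
    · simp [TrivSqZeroExt.snd_sum, Finset.sum_apply, Pi.single_apply]
  rw [hx]
  exact add_mem (hinl _) (sum_mem fun j _ => mul_mem (hinl _) (hinr j))

/-- The point of the double cover over `a`. -/
noncomputable def tangentMap : Spec (.of (DualRing k)) ⟶ coverSurface G :=
  Spec.map (CommRingCat.ofHom (chartTangentHom G hi hw hd)) ≫
    Proj.awayι (coverGrading G) (coverCoord G i) (coverCoord_mem G i) Nat.one_pos

lemma tangentMap_mem_singularPoints :
    tangentMap G hi hw hd (IsLocalRing.closedPoint (DualRing k)) ∈
      singularPoints (coverSurface G) := by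
  exact not_isRegularLocalRing_stalk (CommRingCat.ofHom (chartTangentHom G hi hw hd))
    (chartTangentHom_surjective G hi hw hd) _ (ringKrullDim_coverChart_le G i)

end

/-- If the double cover has isolated singularities, the partial derivatives of `G` have no common
factor. -/
lemma exists_not_dvd_pderiv [IsAlgClosed k] [CharP k 2]
    (hfin : (singularPoints (coverSurface G)).Finite) {p : CoordRing k} (hp : Prime p) :
    ∃ j, ¬ p ∣ pderiv j (G : CoordRing k) := by
  by_contra! H
  obtain ⟨i, hinf⟩ : ∃ i, {a : Fin 3 → k | a i = 1 ∧
      ∀ j, eval a (pderiv j (G : CoordRing k)) = 0}.Infinite := by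
    by_cases h0 : ∀ j, pderiv j (G : CoordRing k) = 0
    · obtain ⟨i, hi⟩ := exists_infinite_zeros (k := k) one_ne_zero (isHomogeneous_X k 0)
        (X_ne_zero _)
      exact ⟨i, hi.mono fun a ha => ⟨ha.1, fun j => by simp [h0]⟩⟩
    -- A factor of the nonzero form `∂ⱼG` is itself a form, here of positive degree since a prime is
    -- not a unit, so it defines a curve.
    · push Not at h0
      obtain ⟨j, hj⟩ := h0
      obtain ⟨e, he⟩ := exists_isHomogeneous_of_dvd
        ((mem_homogeneousSubmodule _ _).mp (pderiv_mem G j)) hj (H j)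
      have he0 : e ≠ 0 := by
        rintro rfl
        have h1 : p = C (coeff 0 p) := by
          rw [← homogeneousComponent_zero]
          exact (homogeneousComponent_eq_self he).symm
        refine hp.not_isUnit ?_
        rw [h1]
        refine (isUnit_iff_ne_zero.mpr fun h => hp.ne_zero ?_).map C
        rw [h1, h, map_zero]
      obtain ⟨i, hi⟩ := exists_infinite_zeros he0 he hp.ne_zero
      refine ⟨i, hi.mono fun a ha => ⟨ha.1, fun j => ?_⟩⟩
      obtain ⟨q, hq⟩ := H j
      rw [hq, map_mul, ha.2, zero_mul]
  have hsq : ∀ c : k, ∃ w, w ^ 2 = c := fun c => IsAlgClosed.exists_pow_nat_eq c two_pos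
  choose r hr using hsq
  let Φ : {a : Fin 3 → k | a i = 1 ∧ ∀ j, eval a (pderiv j (G : CoordRing k)) = 0} →
      coverSurface G := fun a => tangentMap G a.2.1 (hr (eval a.1 (G : CoordRing k))) a.2.2
      (IsLocalRing.closedPoint (DualRing k))
  have hΦ : Function.Injective Φ := by
    intro a b hab
    simp only [Φ, tangentMap] at hab
    replace hab := (Proj.awayι (coverGrading G) (coverCoord G i) (coverCoord_mem G i)
      Nat.one_pos).isOpenEmbedding.injective hab
    refine Subtype.ext (funext fun j => ?_)
    -- The function `Xⱼ / Xᵢ - a j` vanishes at the point over `c` exactly when `c j = a j`, so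
    -- distinct zeros of `dG` give distinct singular points.
    have hmem : ∀ (c : {a : Fin 3 → k | a i = 1 ∧
        ∀ j, eval a (pderiv j (G : CoordRing k)) = 0}),
        chartIncl G i (coord i j) - chartIncl G i (scalar k i (a.1 j)) ∈
          PrimeSpectrum.asIdeal (Spec.map (CommRingCat.ofHom (chartTangentHom G c.2.1
            (hr (eval c.1 (G : CoordRing k))) c.2.2)) (IsLocalRing.closedPoint (DualRing k))) ↔
        c.1 j = a.1 j := by
      intro c
      change chartTangentHom G c.2.1 (hr (eval c.1 (G : CoordRing k))) c.2.2 _ ∈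
        IsLocalRing.maximalIdeal (DualRing k) ↔ _
      rw [mem_maximalIdeal_dualRing, map_sub, scalar_eq_frac, coord, chartTangentHom_frac,
        chartTangentHom_frac, aeval_X, aeval_C]
      rw [TrivSqZeroExt.fst_sub, sub_eq_zero]
      simp [TrivSqZeroExt.algebraMap_eq_inl]
    have h1 := (hmem a).mpr rfl
    exact ((hmem b).mp ((SetLike.ext_iff.mp (congrArg PrimeSpectrum.asIdeal hab) _).mp h1)).symm
  have := hinf.to_subtype
  refine (Set.infinite_range_of_injective hΦ) (hfin.subset ?_)
  rintro _ ⟨a, rfl⟩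
  exact tangentMap_mem_singularPoints G _ _ _

end Singularities

/-! ### The zero scheme determines the sextic up to scalars and squares -/

section ZeroSchemes

open MvPolynomial HomogeneousLocalization

variable {k : Type*} [Field k]

/-- Clearing denominators: membership on a chart becomes membership of forms up to a power of `Xᵢ`,
the input for saturation. -/
lemma exists_X_pow_mul_mem {i : Fin 3} {n : ℕ} {g : Fin 3 → CoordRing k}
    (hg : ∀ l, g l ∈ Form k n) {u : CoordRing k} (hu : u ∈ Form k n)
    (h : frac i n u hu ∈ Ideal.span (Set.range fun l => frac i n (g l) (hg l))) :
    ∃ N : ℕ, X i ^ N * u ∈ Ideal.span (Set.range g) := by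
  set L := Localization (Submonoid.powers (X i : CoordRing k))
  have hval : ∀ v hv, algebraMap (CoordRing k) L v =
      algebraMap (CoordRing k) L (X i ^ n) * algebraMap (ChartRing k i) L (frac i n v hv) := by
    intro v hv
    rw [HomogeneousLocalization.algebraMap_apply, val_frac, ← Localization.mk_one_eq_algebraMap,
      ← Localization.mk_one_eq_algebraMap, Localization.mk_mul, Localization.mk_eq_mk_iff,
      Localization.r_iff_exists]
    exact ⟨1, by simp⟩
  have hunit : IsUnit (algebraMap (CoordRing k) L (X i ^ n)) :=
    IsLocalization.map_units L (⟨X i ^ n, n, rfl⟩ : Submonoid.powers (X i : CoordRing k))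
  have hmem : algebraMap (CoordRing k) L u ∈
      (Ideal.span (Set.range g)).map (algebraMap (CoordRing k) L) := by
    rw [hval u hu]
    refine Ideal.mul_mem_left _ _ ?_
    have h1 : Ideal.span (Set.range fun l => frac i n (g l) (hg l)) ≤
        ((Ideal.span (Set.range g)).map (algebraMap (CoordRing k) L)).comap
          (algebraMap (ChartRing k i) L) := by
      rw [Ideal.span_le]
      rintro _ ⟨l, rfl⟩
      rw [SetLike.mem_coe, Ideal.mem_comap]
      refine (Ideal.unit_mul_mem_iff_mem _ hunit).mp ?_
      rw [← hval]
      exact Ideal.mem_map_of_mem _ (Ideal.subset_span ⟨l, rfl⟩)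
    exact h1 h
  rw [IsLocalization.mem_map_algebraMap_iff (Submonoid.powers (X i : CoordRing k))] at hmem
  obtain ⟨⟨v, ⟨_, N, rfl⟩⟩, hv⟩ := hmem
  refine ⟨N, ?_⟩
  rw [← map_mul] at hv
  have hinj : Function.Injective (algebraMap (CoordRing k) L) :=
    IsLocalization.injective L (powers_le_nonZeroDivisors_of_noZeroDivisors (X_ne_zero i))
  have h2 := hinj hv
  rw [mul_comm, h2]
  exact v.2

lemma zeroIdeal_le_of_pderiv_eq [CharP k 2] {G G' : Form k 6} {c : k}
    (h : ∀ l, pderiv l (G' : CoordRing k) = C c * pderiv l (G : CoordRing k)) (i : Fin 3) :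
    zeroIdeal (A := ChartRing k i)
      (KaehlerDifferential.D (Form k 0) (ChartRing k i) (dehomogenize G' i)) ≤
    zeroIdeal (A := ChartRing k i)
      (KaehlerDifferential.D (Form k 0) (ChartRing k i) (dehomogenize G i)) := by
  rw [zeroIdeal_eq_span, zeroIdeal_eq_span, Ideal.span_le]
  rintro _ ⟨l, rfl⟩
  have h1 : frac i 5 (pderiv l (G' : CoordRing k)) (pderiv_mem G' l) =
      scalar k i c * frac i 5 (pderiv l (G : CoordRing k)) (pderiv_mem G l) := by
    rw [frac_eq_eval₂, frac_eq_eval₂, h, eval₂_mul, eval₂_C]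
  change frac i 5 _ _ ∈ _
  rw [h1]
  exact Ideal.mul_mem_left _ _ (Ideal.subset_span ⟨l, rfl⟩)

lemma zeroSchemeD_eq_of_eq_add_sq [CharP k 2] {G G' : Form k 6} {c : k} (hc : c ≠ 0)
    {H : CoordRing k} (h : (G' : CoordRing k) = C c * (G : CoordRing k) + H ^ 2) :
    zeroSchemeD G = zeroSchemeD G' := by
  have h1 : ∀ l, pderiv l (G' : CoordRing k) = C c * pderiv l (G : CoordRing k) := by
    intro l
    rw [h, map_add, pderiv_C_mul, sq, pderiv_mul, mul_comm H, CharTwo.add_self_eq_zero, add_zero]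
  have h2 : ∀ l, pderiv l (G : CoordRing k) = C c⁻¹ * pderiv l (G' : CoordRing k) := by
    intro l
    rw [h1, ← mul_assoc, ← C_mul, inv_mul_cancel₀ hc, C_1, one_mul]
  have h3 : ∀ i, zeroIdeal (A := ChartRing k i)
      (KaehlerDifferential.D (Form k 0) (ChartRing k i) (dehomogenize G i)) =
      zeroIdeal (A := ChartRing k i)
      (KaehlerDifferential.D (Form k 0) (ChartRing k i) (dehomogenize G' i)) := fun i =>
    le_antisymm (zeroIdeal_le_of_pderiv_eq h2 i) (zeroIdeal_le_of_pderiv_eq h1 i)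
  unfold zeroSchemeD
  simp only [h3]

lemma finite_singularPoints {G : Form k 6} (hG : G ∈ nodalLocus k) :
    (singularPoints (coverSurface G)).Finite :=
  -- `ncard` is `0` on infinite sets, so the value `21` forces finiteness.
  Set.finite_of_ncard_ne_zero (by rw [hG.2.1]; norm_num)

lemma pderiv_ne_zero {G : Form k 6} (hp : ∀ p : CoordRing k, Prime p →
    ∃ j, ¬ p ∣ pderiv j (G : CoordRing k)) : (fun j => pderiv j (G : CoordRing k)) ≠ 0 := by
  intro h0
  obtain ⟨j, hj⟩ := hp (X 0) X_prime
  exact hj (by rw [congrFun h0 j]; exact dvd_zero _)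

lemma exists_pderiv_eq_C_mul [CharP k 2] {G G' : Form k 6}
    (hp : ∀ p : CoordRing k, Prime p → ∃ j, ¬ p ∣ pderiv j (G : CoordRing k))
    (h : zeroSchemeD G = zeroSchemeD G') :
    ∃ c : k, ∀ j, pderiv j (G' : CoordRing k) = C c * pderiv j (G : CoordRing k) := by
  refine exists_eq_C_mul (g := fun j => pderiv j (G : CoordRing k))
    (g' := fun j => pderiv j (G' : CoordRing k)) (pderiv_ne_zero hp) hp (euler G)
    (fun j => (mem_homogeneousSubmodule _ _).mp (pderiv_mem G j)) (euler G')
    (fun j => (mem_homogeneousSubmodule _ _).mp (pderiv_mem G' j)) fun i j => ?_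
  refine exists_X_pow_mul_mem (i := i) (pderiv_mem G) (pderiv_mem G' j) ?_
  have h1 := zeroIdeal_le_of_zeroSchemeD_le h.ge i
  rw [zeroIdeal_eq_span, zeroIdeal_eq_span] at h1
  exact h1 (Ideal.subset_span ⟨j, rfl⟩)

lemma exists_eq_add_sq_of_zeroSchemeD_eq [IsAlgClosed k] [CharP k 2] {G G' : Form k 6}
    (hG : G ∈ nodalLocus k) (hG' : G' ∈ nodalLocus k) (h : zeroSchemeD G = zeroSchemeD G') :
    ∃ c : k, c ≠ 0 ∧ ∃ H : Form k 3,
      (G' : CoordRing k) = C c * (G : CoordRing k) + (H : CoordRing k) ^ 2 := by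
  obtain ⟨c, hc⟩ := exists_pderiv_eq_C_mul
    (fun p hp => exists_not_dvd_pderiv _ (finite_singularPoints hG) hp) h
  have hne := pderiv_ne_zero
    (fun p hp => exists_not_dvd_pderiv G' (finite_singularPoints hG') hp)
  have hc0 : c ≠ 0 := by
    rintro rfl
    refine hne (funext fun j => ?_)
    change pderiv j (G' : CoordRing k) = 0
    rw [hc j, C_0, zero_mul]
  have := Fact.mk Nat.prime_two
  have h1 : ((G' : CoordRing k) - C c * (G : CoordRing k)).IsHomogeneous (2 * 3) :=
    IsHomogeneous.sub ((mem_homogeneousSubmodule _ _).mp G'.2)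
      (IsHomogeneous.C_mul ((mem_homogeneousSubmodule _ _).mp G.2) c)
  obtain ⟨H, hH, hsq⟩ := exists_eq_sq_of_pderiv_eq_zero h1
    (fun j => by rw [map_sub, pderiv_C_mul, hc j, sub_self])
  exact ⟨c, hc0, ⟨H, (mem_homogeneousSubmodule _ _).mpr hH⟩, by rw [← hsq]; ring⟩

end ZeroSchemes

/-! ### Isomorphisms of projective spectra from graded rings -/

section ProjMap

open HomogeneousLocalization HomogeneousIdeal

universe u

variable {A B σ τ : Type u} [CommRing A] [SetLike σ A] [AddSubgroupClass σ A]
  [CommRing B] [SetLike τ B] [AddSubgroupClass τ B]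
  {𝒜 : ℕ → σ} {ℬ : ℕ → τ} [GradedRing 𝒜] [GradedRing ℬ]

lemma irrelevant_le_map_of_rightInverse (f : GradedRingHom 𝒜 ℬ) (g : GradedRingHom ℬ 𝒜)
    (h : ∀ x, f (g x) = x) :
    HomogeneousIdeal.irrelevant ℬ ≤ (HomogeneousIdeal.irrelevant 𝒜).map f := by
  refine toIdeal_le_toIdeal_iff.mp ((toIdeal_irrelevant_le _).mpr fun n hn x hx => ?_)
  rw [← h x]
  exact Ideal.mem_map_of_mem f (mem_irrelevant_of_mem 𝒜 hn (g.map_mem hx))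

lemma projMap_comp_eq_id (f : GradedRingHom 𝒜 ℬ) (g : GradedRingHom ℬ 𝒜) (hf hg)
    (h : ∀ x, g (f x) = x) : Proj.map g hg ≫ Proj.map f hf = 𝟙 (Proj 𝒜) := by
  rw [← Proj.map_comp]
  have h1 : ∀ (φ : GradedRingHom 𝒜 𝒜) (hφ), φ = GradedRingHom.id 𝒜 →
      Proj.map φ hφ = 𝟙 (Proj 𝒜) := by
    rintro _ _ rfl
    exact Proj.map_id
  exact h1 _ _ (GradedRingHom.ext h)

/-- The isomorphism of projective spectra induced by an isomorphism of graded rings. -/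
noncomputable def projIso (f : GradedRingHom 𝒜 ℬ) (g : GradedRingHom ℬ 𝒜)
    (hfg : ∀ x, f (g x) = x) (hgf : ∀ x, g (f x) = x) : Proj ℬ ≅ Proj 𝒜 where
  hom := Proj.map f (irrelevant_le_map_of_rightInverse f g hfg)
  inv := Proj.map g (irrelevant_le_map_of_rightInverse g f hgf)
  hom_inv_id := projMap_comp_eq_id g f _ _ hfg
  inv_hom_id := projMap_comp_eq_id f g _ _ hgf

/-- The target element `t` is only propositionally equal to `f s`, which allows `f` to fix the
coordinates without a cast between localizations. -/
lemma exists_awayι_comp_map (f : GradedRingHom 𝒜 ℬ) (hf) {s : A} {t : B} (h : f s = t) {i : ℕ}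
    (hi : 0 < i) (hs : s ∈ 𝒜 i) (ht : t ∈ ℬ i) :
    ∃ ρ : Away 𝒜 s →+* Away ℬ t,
      (∀ n a ha ha', ρ (Away.mk 𝒜 hs n a ha) = Away.mk ℬ ht n (f a) ha') ∧
      Proj.awayι ℬ t ht hi ≫ Proj.map f hf =
        Spec.map (CommRingCat.ofHom ρ) ≫ Proj.awayι 𝒜 s hs hi := by
  subst h
  exact ⟨Away.map f s, fun n a ha _ => Away.map_mk _ _ _ _ _ _, Proj.awayι_comp_map f hf hi s hs⟩

end ProjMap

/-! ### From `G' = c G + H²` to an isomorphism of covers -/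

section CoverIso

open MvPolynomial HomogeneousLocalization

universe u

variable {k : Type u} [Field k] {G G' : Form k 6}

lemma awayι_coverProj (G : Form k 6) (i : Fin 3) :
    Proj.awayι (coverGrading G) (coverCoord G i) (coverCoord_mem G i) Nat.one_pos ≫ coverProj G =
      Spec.map (CommRingCat.ofHom (chartIncl G i)) ≫ chartMap k i :=
  (coverCharts G).openCover.ι_glueMorphisms (chartProj G) (chartProj_compat G) i

lemma eval₂_C_mul_root_add_eq_zero [CharP k 2] {d : k} {H : Form k 3}
    (h : (G' : CoordRing k) = C (d ^ 2) * (G : CoordRing k) + (H : CoordRing k) ^ 2) :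
    (Polynomial.X ^ 2 - Polynomial.C (G' : CoordRing k)).eval₂
      (AdjoinRoot.of (Polynomial.X ^ 2 - Polynomial.C (G : CoordRing k)))
      (AdjoinRoot.of _ (C d) * AdjoinRoot.root _ + AdjoinRoot.of _ (H : CoordRing k)) = 0 := by
  have h2 : (2 : CoverRing G) = 0 := by
    have h3 := congrArg (AdjoinRoot.of (Polynomial.X ^ 2 - Polynomial.C (G : CoordRing k)))
      (CharTwo.two_eq_zero (R := CoordRing k))
    rwa [map_ofNat, map_zero] at h3
  rw [Polynomial.eval₂_sub, Polynomial.eval₂_pow, Polynomial.eval₂_X, Polynomial.eval₂_C, h,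
    map_add, map_mul, map_pow, map_pow, map_pow, ← root_sq]
  linear_combination (AdjoinRoot.of _ (C d) * AdjoinRoot.root _ * AdjoinRoot.of _ (H : CoordRing k)) * h2

/-- The substitution `W ↦ d W + H`, as a homomorphism of the homogeneous coordinate rings of double
covers. -/
noncomputable def coverHom [CharP k 2] {d : k} {H : Form k 3}
    (h : (G' : CoordRing k) = C (d ^ 2) * (G : CoordRing k) + (H : CoordRing k) ^ 2) :
    GradedRingHom (coverGrading G') (coverGrading G) where
  __ := AdjoinRoot.lift (AdjoinRoot.of _) _ (eval₂_C_mul_root_add_eq_zero h)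
  map_mem {n x} hx := by
    change AdjoinRoot.lift (AdjoinRoot.of _) _ (eval₂_C_mul_root_add_eq_zero h) x ∈ _
    have hr : (AdjoinRoot.of _ (C d) * AdjoinRoot.root _ + AdjoinRoot.of _ (H : CoordRing k) :
        CoverRing G) ∈ coverGrading G 3 := by
      refine add_mem ?_ (of_mem G H.2)
      have := SetLike.mul_mem_graded (A := coverGrading G)
        (of_mem G ((mem_homogeneousSubmodule _ _).mpr (isHomogeneous_C (Fin 3) d))) (root_mem G)
      simpa using this
    induction hx using Submodule.span_induction with
    | zero => rw [map_zero]; exact zero_mem _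
    | add x y _ _ hx hy => rw [map_add]; exact add_mem hx hy
    | smul c x _ hx =>
      have h1 : algebraMap k (CoverRing G') c = AdjoinRoot.of _ (C c) := rfl
      rw [Algebra.smul_def, map_mul, h1, AdjoinRoot.lift_of]
      have h2 : (AdjoinRoot.of _ (C c) : CoverRing G) = algebraMap k (CoverRing G) c := rfl
      rw [h2, ← Algebra.smul_def]
      exact Submodule.smul_mem _ _ hx
    | mem x hx =>
      obtain ⟨m, j, rfl, a, ha, rfl⟩ := hx
      rw [map_mul, map_pow, AdjoinRoot.lift_of, AdjoinRoot.lift_root]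
      have := SetLike.mul_mem_graded (A := coverGrading G) (of_mem G ha) (SetLike.pow_mem_graded j hr)
      rwa [smul_eq_mul, mul_comm j] at this

lemma coverHom_of [CharP k 2] {d : k} {H : Form k 3}
    (h : (G' : CoordRing k) = C (d ^ 2) * (G : CoordRing k) + (H : CoordRing k) ^ 2)
    (a : CoordRing k) : coverHom h (AdjoinRoot.of _ a) = AdjoinRoot.of _ a :=
  AdjoinRoot.lift_of (eval₂_C_mul_root_add_eq_zero h)

lemma coverHom_root [CharP k 2] {d : k} {H : Form k 3}
    (h : (G' : CoordRing k) = C (d ^ 2) * (G : CoordRing k) + (H : CoordRing k) ^ 2) :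
    coverHom h (AdjoinRoot.root _) =
      AdjoinRoot.of _ (C d) * AdjoinRoot.root _ + AdjoinRoot.of _ (H : CoordRing k) :=
  AdjoinRoot.lift_root (eval₂_C_mul_root_add_eq_zero h)

lemma coverHom_coverHom [CharP k 2] {d e : k} {H K : Form k 3}
    (h : (G' : CoordRing k) = C (d ^ 2) * (G : CoordRing k) + (H : CoordRing k) ^ 2)
    (h' : (G : CoordRing k) = C (e ^ 2) * (G' : CoordRing k) + (K : CoordRing k) ^ 2)
    (hde : d * e = 1) (hHK : C d * (K : CoordRing k) + (H : CoordRing k) = 0) (x : CoverRing G') :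
    coverHom h' (coverHom h x) = x := by
  have h1 : ((coverHom h').toRingHom.comp (coverHom h).toRingHom) = RingHom.id (CoverRing G') := by
    refine AdjoinRoot.ringHom_ext ?_ ?_
    · refine RingHom.ext fun a => ?_
      change coverHom h' (coverHom h (AdjoinRoot.of _ a)) = AdjoinRoot.of _ a
      rw [coverHom_of, coverHom_of]
    · change coverHom h' (coverHom h (AdjoinRoot.root _)) = AdjoinRoot.root _
      rw [coverHom_root, map_add, map_mul, coverHom_of, coverHom_of, coverHom_root, mul_add,
        ← mul_assoc, ← map_mul, ← C_mul, hde, add_assoc, ← map_mul, ← map_add, hHK, C_1, map_one,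
        map_zero, one_mul, add_zero]
  exact RingHom.congr_fun h1 x

lemma projMap_comp_coverProj (Φ : GradedRingHom (coverGrading G') (coverGrading G)) (hΦ)
    (h : ∀ a, Φ (AdjoinRoot.of _ a) = AdjoinRoot.of _ a) :
    Proj.map Φ hΦ ≫ coverProj G' = coverProj G := by
  suffices H : ∀ i : Fin 3,
      Proj.awayι (coverGrading G) (coverCoord G i) (coverCoord_mem G i) Nat.one_pos ≫
        Proj.map Φ hΦ ≫ coverProj G' =
      Proj.awayι (coverGrading G) (coverCoord G i) (coverCoord_mem G i) Nat.one_pos ≫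
        coverProj G from (coverCharts G).openCover.hom_ext _ _ H
  intro i
  obtain ⟨ρ, hρ, hcomp⟩ := exists_awayι_comp_map Φ hΦ (s := coverCoord G' i) (t := coverCoord G i)
    (h _) Nat.one_pos (coverCoord_mem G' i) (coverCoord_mem G i)
  rw [← Category.assoc, hcomp, Category.assoc, awayι_coverProj, awayι_coverProj, ← Category.assoc,
    ← Spec.map_comp, ← CommRingCat.ofHom_comp]
  congr 3
  refine RingHom.ext fun s => ?_
  obtain ⟨n, a, ha, rfl⟩ := Away.mk_surjective (Form k) (X_mem k i) s
  have ha' : a ∈ Form k n := by simpa using ha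
  rw [RingHom.comp_apply]
  unfold chartIncl
  rw [Away.map_mk, Away.map_mk, hρ _ _ _ (by rw [smul_eq_mul, mul_one]; exact h a ▸ of_mem G ha')]
  refine val_injective _ ?_
  rw [Away.val_mk, Away.val_mk]
  exact congrArg (fun z => Localization.mk z _) (h a)

lemma nonempty_iso_of_eq_add_sq [IsAlgClosed k] [CharP k 2] {c : k} (hc : c ≠ 0) {H : Form k 3}
    (h : (G' : CoordRing k) = C c * (G : CoordRing k) + (H : CoordRing k) ^ 2) :
    Nonempty (Over.mk (coverProj G) ≅ Over.mk (coverProj G')) := by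
  obtain ⟨d, rfl⟩ := IsAlgClosed.exists_pow_nat_eq c (n := 2) two_pos
  have hd : d ≠ 0 := by rintro rfl; simp at hc
  have hCd : (C d⁻¹ : CoordRing k) * C d = 1 := by rw [← C_mul, inv_mul_cancel₀ hd, C_1]
  -- The inverse substitution is `W ↦ d⁻¹ (W - H)`, and the sign disappears in characteristic two.
  let K : Form k 3 := d⁻¹ • H
  have hK : (K : CoordRing k) = C d⁻¹ * (H : CoordRing k) := by
    change d⁻¹ • (H : CoordRing k) = _
    rw [smul_eq_C_mul]
  have h2 : (2 : CoordRing k) = 0 := CharTwo.two_eq_zero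
  have h' : (G : CoordRing k) = C (d⁻¹ ^ 2) * (G' : CoordRing k) + (K : CoordRing k) ^ 2 := by
    rw [hK, h, C_pow, C_pow]
    linear_combination (-(C d⁻¹ * (C d) + 1) * (G : CoordRing k)) * hCd -
      (C d⁻¹ * (H : CoordRing k)) ^ 2 * h2
  have e1 : ∀ x, coverHom h' (coverHom h x) = x := coverHom_coverHom h h' (mul_inv_cancel₀ hd) (by
    rw [hK]
    linear_combination (H : CoordRing k) * hCd + (H : CoordRing k) * h2)
  have e2 : ∀ x, coverHom h (coverHom h' x) = x := coverHom_coverHom h' h (inv_mul_cancel₀ hd) (by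
    rw [hK]
    linear_combination C d⁻¹ * (H : CoordRing k) * h2)
  exact ⟨Over.isoMk (projIso (coverHom h) (coverHom h') e2 e1)
    (projMap_comp_coverProj (coverHom h) _ (coverHom_of h))⟩

end CoverIso

/-! ### From an isomorphism of covers to `G' = c G + H²` -/

section OverIso

open MvPolynomial HomogeneousLocalization

universe u

variable {k : Type u} [Field k] {G G' : Form k 6}

lemma of_add_of_mul_root_eq_zero {p q : CoordRing k}
    (h : (AdjoinRoot.of _ p + AdjoinRoot.of _ q * AdjoinRoot.root _ : CoverRing G) = 0) :
    p = 0 ∧ q = 0 := by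
  have h1 : AdjoinRoot.mk (Polynomial.X ^ 2 - Polynomial.C (G : CoordRing k))
      (Polynomial.C q * Polynomial.X + Polynomial.C p) = 0 := by
    rw [← h, map_add, map_mul, AdjoinRoot.mk_C, AdjoinRoot.mk_C, AdjoinRoot.mk_X, add_comm]
  rw [AdjoinRoot.mk_eq_zero] at h1
  have h2 : Polynomial.C q * Polynomial.X + Polynomial.C p = 0 := by
    by_contra h0
    refine (Polynomial.monic_X_pow_sub_C (G : CoordRing k) two_ne_zero).not_dvd_of_degree_lt h0 ?_ h1
    rw [Polynomial.degree_X_pow_sub_C two_pos]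
    exact Polynomial.degree_linear_lt
  have h3 := congrArg (Polynomial.coeff · 0) h2
  have h4 := congrArg (Polynomial.coeff · 1) h2
  simp only [Polynomial.coeff_add, Polynomial.coeff_mul_X_zero, Polynomial.coeff_C_zero,
    Polynomial.coeff_zero, zero_add] at h3
  rw [h3] at h4
  exact ⟨h3, by simpa using h4⟩

/-- Clearing denominators reduces this to `W² - G` being monic of degree two. Together with
`exists_eq_add_mul_rootFun`, the chart is free of rank two over the chart of the plane. -/
lemma chartIncl_add_mul_rootFun_eq_zero {i : Fin 3} {α β : ChartRing k i}
    (h : chartIncl G i α + chartIncl G i β * rootFun G i = 0) : α = 0 ∧ β = 0 := by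
  obtain ⟨n, a, ha, rfl⟩ := exists_eq_frac α
  obtain ⟨m, b, hb, rfl⟩ := exists_eq_frac β
  have hval := congrArg HomogeneousLocalization.val h
  rw [val_add, val_mul, val_chartIncl_frac, val_chartIncl_frac, val_rootFun, Localization.mk_mul,
    Localization.add_mk, val_zero, ← Localization.mk_zero 1, Localization.mk_eq_mk_iff,
    Localization.r_iff_exists] at hval
  obtain ⟨⟨_, N, rfl⟩, hN⟩ := hval
  have hX : coverCoord G i = AdjoinRoot.of _ (X i) := rfl
  have h1 : (AdjoinRoot.of _ (X i ^ N * X i ^ (m + 3) * a) +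
      AdjoinRoot.of _ (X i ^ N * X i ^ n * b) * AdjoinRoot.root _ : CoverRing G) = 0 := by
    simp only [map_mul, map_pow, ← hX]
    simp only [Submonoid.coe_mul, Submonoid.coe_one, one_mul, mul_zero] at hN
    rw [← hN]
    ring
  obtain ⟨h2, h3⟩ := of_add_of_mul_root_eq_zero h1
  have ha0 : a = 0 := by simpa [X_ne_zero] using h2
  have hb0 : b = 0 := by simpa [X_ne_zero] using h3
  rw [frac_eq_eval₂, frac_eq_eval₂, ha0, hb0, eval₂_zero]
  exact ⟨rfl, rfl⟩

lemma chartIncl_isLocalizationElem (i j : Fin 3) :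
    chartIncl G j (Away.isLocalizationElem (X_mem k j) (X_mem k i)) =
      Away.isLocalizationElem (coverCoord_mem G j) (coverCoord_mem G i) := by
  unfold chartIncl Away.isLocalizationElem
  rw [Away.map_mk]
  refine val_injective _ ?_
  rw [Away.val_mk, Away.val_mk, map_pow]

lemma mem_basicOpen_coverCoord {i : Fin 3} {y : coverSurface G}
    (h : coverProj G y ∈ Proj.basicOpen (Form k) (X i)) :
    y ∈ Proj.basicOpen (coverGrading G) (coverCoord G i) := by
  obtain ⟨j, z, rfl⟩ : ∃ (j : Fin 3) (z : Spec (.of (CoverChart G j))),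
      Proj.awayι (coverGrading G) (coverCoord G j) (coverCoord_mem G j) Nat.one_pos z = y := by
    obtain ⟨j, hj⟩ := TopologicalSpace.Opens.mem_iSup.mp
      ((iSup_basicOpen_coverCoord G).ge (Set.mem_univ y))
    rw [← Proj.opensRange_awayι (coverGrading G) _ (coverCoord_mem G j) Nat.one_pos] at hj
    exact ⟨j, hj⟩
  rw [← Scheme.Hom.comp_apply, awayι_coverProj, Scheme.Hom.comp_apply] at h
  have h1 := (Proj.awayι_preimage_basicOpen (Form k) (X_mem k j) Nat.one_pos (X_mem k i)
    Nat.one_pos).le h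
  change z ∈ Proj.awayι (coverGrading G) (coverCoord G j) (coverCoord_mem G j) Nat.one_pos ⁻¹ᵁ
    Proj.basicOpen (coverGrading G) (coverCoord G i)
  rw [Proj.awayι_preimage_basicOpen (coverGrading G) (coverCoord_mem G j) Nat.one_pos
    (coverCoord_mem G i) Nat.one_pos, ← chartIncl_isLocalizationElem]
  exact h1

/-- The chart of the cover is the full preimage of the chart of the plane, so a morphism over the
plane preserves charts. -/
lemma exists_chartHom (f : coverSurface G ⟶ coverSurface G') (hf : f ≫ coverProj G' = coverProj G)
    (i : Fin 3) : ∃ θ : CoverChart G' i →+* CoverChart G i,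
      Spec.map (CommRingCat.ofHom θ) ≫
        Proj.awayι (coverGrading G') (coverCoord G' i) (coverCoord_mem G' i) Nat.one_pos =
      Proj.awayι (coverGrading G) (coverCoord G i) (coverCoord_mem G i) Nat.one_pos ≫ f ∧
      θ.comp (chartIncl G' i) = chartIncl G i := by
  have hr : Set.range (Proj.awayι (coverGrading G) (coverCoord G i) (coverCoord_mem G i)
      Nat.one_pos ≫ f) ⊆
      Set.range (Proj.awayι (coverGrading G') (coverCoord G' i) (coverCoord_mem G' i)
        Nat.one_pos) := by
    rintro _ ⟨z, rfl⟩
    change _ ∈ (Proj.awayι (coverGrading G') (coverCoord G' i) (coverCoord_mem G' i)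
        Nat.one_pos).opensRange
    rw [Proj.opensRange_awayι]
    refine mem_basicOpen_coverCoord ?_
    rw [← Scheme.Hom.comp_apply, Category.assoc, hf, awayι_coverProj, Scheme.Hom.comp_apply]
    rw [← Proj.opensRange_awayι (Form k) _ (X_mem k i) Nat.one_pos]
    exact ⟨_, rfl⟩
  set φ := IsOpenImmersion.lift _ _ hr with hφ
  have hφf := IsOpenImmersion.lift_fac _ _ hr
  rw [← hφ] at hφf
  refine ⟨(Spec.preimage φ).hom, ?_, ?_⟩
  · rw [CommRingCat.ofHom_hom, Spec.map_preimage]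
    exact hφf
  · have h1 : Spec.map (CommRingCat.ofHom ((Spec.preimage φ).hom.comp (chartIncl G' i))) =
        Spec.map (CommRingCat.ofHom (chartIncl G i)) := by
      rw [← cancel_mono (chartMap k i), ← awayι_coverProj, CommRingCat.ofHom_comp, Spec.map_comp,
        Category.assoc, ← awayι_coverProj, CommRingCat.ofHom_hom, Spec.map_preimage,
        ← Category.assoc, hφf, Category.assoc, hf]
    exact congrArg CommRingCat.Hom.hom (Spec.map_injective h1)

lemma chartHom_comp_eq_id {f : coverSurface G ⟶ coverSurface G'}
    {g : coverSurface G' ⟶ coverSurface G} (hfg : f ≫ g = 𝟙 _) {i : Fin 3}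
    {θ : CoverChart G' i →+* CoverChart G i} {θ' : CoverChart G i →+* CoverChart G' i}
    (h : Spec.map (CommRingCat.ofHom θ) ≫
        Proj.awayι (coverGrading G') (coverCoord G' i) (coverCoord_mem G' i) Nat.one_pos =
      Proj.awayι (coverGrading G) (coverCoord G i) (coverCoord_mem G i) Nat.one_pos ≫ f)
    (h' : Spec.map (CommRingCat.ofHom θ') ≫
        Proj.awayι (coverGrading G) (coverCoord G i) (coverCoord_mem G i) Nat.one_pos =
      Proj.awayι (coverGrading G') (coverCoord G' i) (coverCoord_mem G' i) Nat.one_pos ≫ g) :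
    θ.comp θ' = RingHom.id _ := by
  have h1 : Spec.map (CommRingCat.ofHom (θ.comp θ')) =
      Spec.map (CommRingCat.ofHom (RingHom.id (CoverChart G i))) := by
    rw [← cancel_mono
      (Proj.awayι (coverGrading G) (coverCoord G i) (coverCoord_mem G i) Nat.one_pos),
      CommRingCat.ofHom_comp, Spec.map_comp, Category.assoc, h', ← Category.assoc, h,
      Category.assoc, hfg, CommRingCat.ofHom_id, Spec.map_id, Category.comp_id, Category.id_comp]
  exact congrArg CommRingCat.Hom.hom (Spec.map_injective h1)

/-- If `θ` sends `w'` to `α + β w`, then squaring kills the cross term and gives the equation. If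
`θ'` sends `w` to `γ + δ w'`, then comparing coefficients of `w` in `θ (θ' w) = w` gives `δ β = 1`.
-/
lemma exists_dehomogenize_eq [CharP k 2] {i : Fin 3} {θ : CoverChart G' i →+* CoverChart G i}
    {θ' : CoverChart G i →+* CoverChart G' i} (hθ : θ.comp (chartIncl G' i) = chartIncl G i)
    (h : θ.comp θ' = RingHom.id _) :
    ∃ α β : ChartRing k i, IsUnit β ∧
      dehomogenize G' i = β ^ 2 * dehomogenize G i + α ^ 2 := by
  obtain ⟨α, β, hαβ⟩ := exists_eq_add_mul_rootFun G i (θ (rootFun G' i))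
  obtain ⟨γ, δ, hγδ⟩ := exists_eq_add_mul_rootFun G' i (θ' (rootFun G i))
  have hι : ∀ s, θ (chartIncl G' i s) = chartIncl G i s := RingHom.congr_fun hθ
  have h2 : (2 : ChartRing k i) = 0 := by
    have := congrArg (scalar k i) (CharTwo.two_eq_zero (R := k))
    rwa [map_ofNat, map_zero] at this
  refine ⟨α, β, ?_, ?_⟩
  · have h1 := RingHom.congr_fun h (rootFun G i)
    rw [RingHom.comp_apply, hγδ, map_add, map_mul, hι, hι, hαβ, RingHom.id_apply] at h1
    have h3 : chartIncl G i (γ + δ * α) + chartIncl G i (δ * β - 1) * rootFun G i = 0 := by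
      rw [map_add, map_sub, map_mul, map_mul, map_one]
      linear_combination h1
    exact IsUnit.of_mul_eq_one δ
      (by rw [mul_comm]; exact sub_eq_zero.mp (chartIncl_add_mul_rootFun_eq_zero h3).2)
  · have h1 := congrArg θ (rootFun_sq G' i)
    rw [map_pow, hι, hαβ] at h1
    have h3 : chartIncl G i (dehomogenize G' i - (β ^ 2 * dehomogenize G i + α ^ 2)) +
        chartIncl G i 0 * rootFun G i = 0 := by
      have h4 := congrArg (chartIncl G i) h2
      rw [map_ofNat, map_zero] at h4
      rw [map_sub, map_add, map_mul, map_pow, map_pow, ← rootFun_sq, map_zero]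
      linear_combination -h1 + (chartIncl G i α * chartIncl G i β * rootFun G i) * h4
    exact sub_eq_zero.mp (chartIncl_add_mul_rootFun_eq_zero h3).1

lemma exists_eq_scalar_of_isUnit {i : Fin 3} {β : ChartRing k i} (hβ : IsUnit β) :
    ∃ b : k, b ≠ 0 ∧ β = scalar k i b := by
  obtain ⟨b, hb, h⟩ := MvPolynomial.isUnit_iff_eq_C_of_isReduced.mp (hβ.map (toPoly i))
  exact ⟨b, hb.ne_zero, by rw [← eval₂_toPoly β, h, eval₂_C]⟩

lemma exists_eq_sq_of_frac_eq_sq {i : Fin 3} {F : CoordRing k} (hF : F ∈ Form k 6)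
    {α : ChartRing k i} (h : frac i 6 F hF = α ^ 2) :
    ∃ H ∈ Form k 3, F = H ^ 2 := by
  obtain ⟨n, a, ha, rfl⟩ := exists_eq_frac α
  have hval := congrArg HomogeneousLocalization.val h
  rw [val_pow, val_frac, val_frac, Localization.mk_pow, Localization.mk_eq_mk_iff,
    Localization.r_iff_exists] at hval
  obtain ⟨⟨_, N, rfl⟩, hN⟩ := hval
  have h1 : (X i ^ n) ^ 2 * F = (X i ^ 3 * a) ^ 2 := by
    have := mul_left_cancel₀ (pow_ne_zero N (X_ne_zero i)) hN
    rw [mul_pow, ← pow_mul (X i) 3]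
    exact this
  -- The polynomial ring is integrally closed, so divisibility of squares passes to their roots, and
  -- `F` is a square before homogeneity is considered.
  obtain ⟨H, hH⟩ := (IsIntegrallyClosed.pow_dvd_pow_iff two_ne_zero).mp (Dvd.intro _ h1)
  have h2 : F = H ^ 2 := by
    rw [hH, mul_pow] at h1
    exact mul_left_cancel₀ (pow_ne_zero 2 (pow_ne_zero n (X_ne_zero i))) h1
  -- Factors of a nonzero form are forms; for `F = 0` this argument is not available and the zero
  -- cubic is taken.
  by_cases h0 : F = 0
  · exact ⟨0, zero_mem _, by rw [h0]; ring⟩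
  have hF' := (mem_homogeneousSubmodule _ _).mp hF
  obtain ⟨e, he⟩ := exists_isHomogeneous_of_dvd hF' h0 (h2 ▸ dvd_pow_self H two_ne_zero)
  have h3 := (he.pow 2).inj_right (h2 ▸ hF') (h2 ▸ h0)
  obtain rfl : e = 3 := by omega
  exact ⟨H, (mem_homogeneousSubmodule _ _).mpr he, h2⟩

lemma exists_eq_add_sq_of_iso [CharP k 2]
    (e : Over.mk (coverProj G) ≅ Over.mk (coverProj G')) :
    ∃ c : k, c ≠ 0 ∧ ∃ H : Form k 3,
      (G' : CoordRing k) = C c * (G : CoordRing k) + (H : CoordRing k) ^ 2 := by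
  -- One chart suffices, since a sextic form is a square as soon as its dehomogenization is.
  obtain ⟨θ, h1, h2⟩ := exists_chartHom e.hom.left (Over.w e.hom) 0
  obtain ⟨θ', h1', -⟩ := exists_chartHom e.inv.left (Over.w e.inv) 0
  have hid : e.hom.left ≫ e.inv.left = 𝟙 (coverSurface G) := by
    rw [← Over.comp_left, e.hom_inv_id]
    rfl
  obtain ⟨α, β, hβ, h⟩ := exists_dehomogenize_eq h2 (chartHom_comp_eq_id hid h1 h1')
  obtain ⟨b, hb, rfl⟩ := exists_eq_scalar_of_isUnit hβ
  have hF : (G' : CoordRing k) - C (b ^ 2) * (G : CoordRing k) ∈ Form k 6 :=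
    (mem_homogeneousSubmodule _ _).mpr
      (IsHomogeneous.sub ((mem_homogeneousSubmodule _ _).mp G'.2)
        (IsHomogeneous.C_mul ((mem_homogeneousSubmodule _ _).mp G.2) _))
  obtain ⟨H, hH, hsq⟩ := exists_eq_sq_of_frac_eq_sq (i := 0) hF (α := α) (by
    have hd : ∀ G : Form k 6,
        dehomogenize G 0 = eval₂ (scalar k 0) (coord 0) (G : CoordRing k) := fun G =>
      frac_eq_eval₂ (k := k) 0 6 (G : CoordRing k) G.2
    rw [hd, hd] at h
    rw [frac_eq_eval₂, eval₂_sub, eval₂_mul, eval₂_C, h, map_pow]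
    ring)
  exact ⟨b ^ 2, pow_ne_zero 2 hb, ⟨H, hH⟩, by rw [← hsq]; ring⟩

end OverIso

end PlaneDoubleCover

open PlaneDoubleCover in
theorem proposition1p2 {k : Type*} [Field k] [IsAlgClosed k] [CharP k 2] (G G' : Form k 6)
    (hG : G ∈ nodalLocus k) (hG' : G' ∈ nodalLocus k) :
    List.TFAE [
      Nonempty (Over.mk (coverProj G) ≅ Over.mk (coverProj G')),
      zeroSchemeD G = zeroSchemeD G',
      ∃ c : k, c ≠ 0 ∧ ∃ H : Form k 3,
        (G' : MvPolynomial (Fin 3) k) = MvPolynomial.C c * (G : MvPolynomial (Fin 3) k) +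
          (H : MvPolynomial (Fin 3) k) ^ 2] := by
  tfae_have 1 → 3 := fun ⟨e⟩ => exists_eq_add_sq_of_iso e
  tfae_have 3 → 1 := fun ⟨_, hc, _, h⟩ => nonempty_iso_of_eq_add_sq hc h
  tfae_have 2 → 3 := exists_eq_add_sq_of_zeroSchemeD_eq hG hG'
  tfae_have 3 → 2 := fun ⟨_, hc, _, h⟩ => zeroSchemeD_eq_of_eq_add_sq hc h
  tfae_finish
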